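/- Fix countably infinite sets of constants, of nulls and of variables, and countably many relation symbols of each arity $k\ge 1$. An instance is a finite set of relational atoms whose arguments are constants and nulls; a homomorphism between instances is a map on their elements that is the identity on constants and sends atoms to atoms. A core of an instance $I$ is a subset $C\subseteq I$ into which $I$ has a homomorphism and such that no endomorphism of $C$ has an image strictly contained in $C$. A tuple generating dependency (tgd) is a formula $\forall\bar x,\bar y\,(\alpha(\bar x,\bar y)\rightarrow\exists\bar z\,\beta(\bar x,\bar z))$, where $\alpha$ (possibly empty) and $\beta$ are finite conjunctions of relational atoms over variables and constants. For a finite set $\Sigma$ of tgds, a trigger on $I$ is a pair $(\xi,h)$ with $\xi=(\alpha\rightarrow\beta)\in\Sigma$ and $h$ an assignment of constants and nulls to the variables of $\alpha$ with $h(\alpha)\subseteq I$; it is active if no extension $h'$ of $h$ satisfies $h'(\beta)\subseteq I$. A step of the core chase is possible if there is an active trigger on the current instance $I$; it adds to $I$, in parallel for all active triggers $(\xi,h)$, the atoms $h'(\beta)$, where $h'$ extends $h$ by assigning fresh, pairwise distinct nulls to the existential variables (distinct also for distinct triggers), and then replaces the result by its core. For an instance $I$, let $\mathsf{CT}^{\mathsf{core}}_{I\forall}$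 be the class of all finite sets $\Sigma$ of tgds such that every core chase sequence with $\Sigma$ starting from $I$ (for all choices of fresh nulls and of the cores) is finite. Then for every instance $I$ the set $\mathsf{CT}^{\mathsf{core}}_{I\forall}$ is $\mathsf{RE}$-complete: it is recursively enumerable, and every recursively enumerable set of natural numbers is many-one reducible to it by a computable function. Likewise, with the instance as part of the input, the set of all pairs $(I,\Sigma)$ with $\Sigma\in\mathsf{CT}^{\mathsf{core}}_{I\forall}$ is $\mathsf{RE}$-complete. (Finite sets are presented to the machine as lists of their elements.) -/

import Mathlib

namespace CoreChase

/-! ### Values, terms, atoms, instances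

Constants, nulls, variables and relation names are each a copy of `ℕ`. -/

/-- The elements of instances: `Sum.inl c` is the constant `c`, `Sum.inr n` is the null `n`. -/
abbrev Value : Type := ℕ ⊕ ℕ

/-- The terms of dependencies: `Sum.inl c` is the constant `c`, `Sum.inr v` is the variable `v`. -/
abbrev Term : Type := ℕ ⊕ ℕ

/-- A relational atom `R(t₁,…,tₖ)` with `k ≥ 1`, stored as `(R, t₁, [t₂,…,tₖ])`. A relation symbol
is a name together with a positive arity, so for every arity `k ≥ 1` there are countably many
relation symbols, and equal names with different arities are different symbols. -/
abbrev Atom (T : Type) : Type := ℕ × T × List T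

/-- The argument sequence of an atom. -/
def Atom.args {T : Type} (a : Atom T) : List T := a.2.1 :: a.2.2

/-- Apply a map to all arguments of an atom. -/
def Atom.map {T U : Type} (f : T → U) (a : Atom T) : Atom U := (a.1, f a.2.1, a.2.2.map f)

/-- A relational instance: a finite set of atoms over constants and nulls. -/
abbrev Instance : Type := Finset (Atom Value)

/-! ### Homomorphisms and cores -/

/-- `h` is a homomorphism from `I` to `J`: it is the identity on constants and `h(I) ⊆ J`.
(Only the values of `h` on the elements of `I` matter.) -/
def IsHom (h : Value → Value) (I J : Instance) : Prop :=
  (∀ c : ℕ, h (Sum.inl c) = Sum.inl c) ∧ I.image (Atom.map h) ⊆ J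

/-- `C` is a core of `I`: a subset of `I` into which `I` has an endomorphism, such that no
endomorphism of `C` has an image strictly smaller than `C`. -/
def IsCore (C I : Instance) : Prop :=
  C ⊆ I ∧ (∃ h, IsHom h I C) ∧ ¬ ∃ g, IsHom g C C ∧ C.image (Atom.map g) ⊂ C

/-! ### Tuple generating dependencies -/

/-- The set of variables that occur in a conjunction of atoms. -/
def varsOf (L : List (Atom Term)) : Finset ℕ :=
  ((L.flatMap Atom.args).filterMap Sum.getRight?).toFinset

/-- A tuple generating dependency `body → ∃ z̄ head`, given by two finite conjunctions of atoms. The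
variables of the body are universally quantified, the remaining variables of the head
existentially. Constants may occur, and the body may be the empty conjunction. -/
abbrev TGD : Type := List (Atom Term) × List (Atom Term)

instance : DecidableEq TGD :=
  @instDecidableEqProd _ _ inferInstance inferInstance

/-- The body of a tgd. -/
def TGD.body (ξ : TGD) : List (Atom Term) := ξ.1

/-- The head of a tgd. -/
def TGD.head (ξ : TGD) : List (Atom Term) := ξ.2

/-- The existentially quantified variables of a tgd. -/
def TGD.exVars (ξ : TGD) : Finset ℕ := varsOf (TGD.head ξ) \ varsOf (TGD.body ξ)

/-- The value of a term under an assignment of values to the variables. -/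
def termVal (f : ℕ → Value) : Term → Value := Sum.elim Sum.inl f

/-- `f` maps every atom of the conjunction `L` into `I`. -/
def MapsInto (f : ℕ → Value) (L : List (Atom Term)) (I : Instance) : Prop :=
  ∀ a ∈ L, Atom.map (termVal f) a ∈ I

/-! ### Triggers -/

/-- A pair `(ξ, h)` of a tgd and an assignment of values to exactly the variables of its body. -/
abbrev PreTrigger : Type := (ξ : TGD) × (varsOf (TGD.body ξ) → Value)

/-- The extension of the assignment `h` of `(ξ, h)` that agrees with `g` on all variables which do
not occur in the body of `ξ`. Every extension of `h` has this form. -/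
def PreTrigger.extend (t : PreTrigger) (g : ℕ → Value) (v : ℕ) : Value :=
  if hv : v ∈ varsOf (TGD.body t.1) then t.2 ⟨v, hv⟩ else g v

/-- `(ξ, h)` is a trigger for `S` on `I`: `ξ ∈ S` and `h` maps the body of `ξ` into `I`. (The
assignment `g` is irrelevant: `h` is defined on all variables of the body.) -/
def IsTrigger (S : Finset TGD) (I : Instance) (t : PreTrigger) : Prop :=
  t.1 ∈ S ∧ ∀ g : ℕ → Value, MapsInto (PreTrigger.extend t g) (TGD.body t.1) I

/-- A trigger `(ξ, h)` is active if no extension of `h` maps the head of `ξ` into `I`. -/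
def IsActive (S : Finset TGD) (I : Instance) (t : PreTrigger) : Prop :=
  IsTrigger S I t ∧ ¬ ∃ g : ℕ → Value, MapsInto (PreTrigger.extend t g) (TGD.head t.1) I

/-! ### The core chase -/

/-- The choice of the null `ν t z` for the existential variable `z` of each active trigger `t` is
fresh: the nulls do not occur in `I`, and different pairs `(t, z)` receive different nulls. -/
def IsFresh (S : Finset TGD) (I : Instance) (ν : PreTrigger → ℕ → ℕ) : Prop :=
  (∀ t, IsActive S I t → ∀ z ∈ TGD.exVars t.1, ∀ a ∈ I, Sum.inr (ν t z) ∉ Atom.args a) ∧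
  ∀ t, IsActive S I t → ∀ z ∈ TGD.exVars t.1, ∀ t', IsActive S I t' → ∀ z' ∈ TGD.exVars t'.1,
    ν t z = ν t' z' → t = t' ∧ z = z'

/-- `K` is the result of firing in parallel all active triggers on `I`, with the fresh nulls `ν`:
the union of `I` with the images of the heads of all active triggers. -/
def IsParallelFiring (S : Finset TGD) (I : Instance) (ν : PreTrigger → ℕ → ℕ) (K : Instance) :
    Prop :=
  ∀ a, a ∈ K ↔ a ∈ I ∨ ∃ t, IsActive S I t ∧ ∃ b ∈ TGD.head t.1,
    a = Atom.map (termVal (PreTrigger.extend t fun z => Sum.inr (ν t z))) b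

/-- One step of the core chase: there is an active trigger on `I`, all active triggers on `I` are
fired in parallel with fresh nulls, and `J` is a core of the result. -/
def CoreStep (S : Finset TGD) (I J : Instance) : Prop :=
  (∃ t, IsActive S I t) ∧
  ∃ (ν : PreTrigger → ℕ → ℕ) (K : Instance),
    IsFresh S I ν ∧ IsParallelFiring S I ν K ∧ IsCore J K

/-- The core chase with `S` on `I` terminates on all branches, a branch being given by a choice of
the fresh nulls and of the core in every step: no core chase sequence from `I` is infinite. -/
def CoreChaseTerminates (S : Finset TGD) (I : Instance) : Prop :=
  ¬ ∃ s : ℕ → Instance, s 0 = I ∧ ∀ n, CoreStep S (s n) (s (n + 1))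

/-- The class of all finite sets of tgds with which the core chase on `I` terminates on all
branches. -/
def CTcore (I : Instance) : Set (Finset TGD) := {S | CoreChaseTerminates S I}

/-! ### Completeness for the recursively enumerable sets -/

/-- `p` is recursively enumerable, and every recursively enumerable set of natural numbers is
many-one reducible to `p` by a computable function. -/
def REComplete {α : Type} [Primcodable α] (p : α → Prop) : Prop :=
  REPred p ∧ ∀ q : ℕ → Prop, REPred q → q ≤₀ p

end CoreChase

/-! ### Termination of the core chase means existence of a finite universal model. -/

namespace CoreChase

/-! ### Maps of atoms, and finite universal models -/

/-! The key fact is `coreChaseTerminates_iff`: the core chase on `I` terminates exactly when there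
is a finite model `U` that receives a homomorphism from `I` and maps into some `J` obtained from `I`
by firing finitely many triggers, active or not. Such a `J` maps into every model that receives `I`
(`Deriv.homTo_model`), so `U` is universal. If no such `U` exists, every instance that receives `I`
and maps into a derived instance has an active trigger, and a core step preserves both properties,
so the chase runs forever. Conversely, along an infinite chase `J` eventually maps into the current
instance, and every instance maps into `U`; hence some core in the sequence is homomorphically
equivalent to `U`. A core equivalent to a model is itself a model (`IsCore.model`), so no further
step is possible.

Recursive enumerability follows because the right side has finite certificates: the triggers fired,
the atoms of `U`, two maps of nulls and a bound for the variables. Checking one involves only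
quantifiers over computable finite lists and is primitive recursive (`primrecPred_certifies`).

For hardness, a recursively enumerable set is the halting set of a `Turing.ToPartrec.Code`. Codes
are evaluated by one fixed finite system of rules that rewrite binary trees at the root
(`eval_dom_iff`). Each rule becomes a tgd: if the left pattern matches the root of a configuration,
build the right pattern and link the two roots by an edge; one more tgd creates the initial tree. If
the rewriting halts at a tree, the instance recording the whole run is a derived finite model. If
not, derived instances contain arbitrarily long chains of edges. All of these would map through `U`
into one derived instance `J`, but in `J` edges lead to newer nulls, which bounds the length of
chains (`Chain.le_rank`). The tgds use a relation name absent from `I`, so the given instance does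
not interfere. -/

theorem Atom.map_map {T U V : Type} (g : U → V) (f : T → U) (a : Atom T) :
    Atom.map g (Atom.map f a) = Atom.map (g ∘ f) a := by
  simp [Atom.map]

theorem Atom.args_map {T U : Type} (f : T → U) (a : Atom T) :
    Atom.args (Atom.map f a) = (Atom.args a).map f := by
  simp [Atom.map, Atom.args]

theorem Atom.map_congr {T U : Type} {f g : T → U} {a : Atom T}
    (h : ∀ x ∈ Atom.args a, f x = g x) : Atom.map f a = Atom.map g a := by
  obtain ⟨r, x, l⟩ := a
  simp only [Atom.args, List.mem_cons, forall_eq_or_imp] at h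
  simp only [Atom.map, h.1, List.map_congr_left h.2]

theorem Atom.map_injOn {T U : Type} {f g : T → U} {a : Atom T}
    (h : Atom.map f a = Atom.map g a) : ∀ x ∈ Atom.args a, f x = g x := by
  have h' : (Atom.args a).map f = (Atom.args a).map g := by
    rw [← Atom.args_map, ← Atom.args_map, h]
  exact List.map_inj_left.1 h'

theorem Atom.map_id' {T : Type} (a : Atom T) : Atom.map (fun x => x) a = a := by
  simp [Atom.map]

theorem termVal_comp (g f : ℕ → Value) :
    termVal g ∘ termVal f = termVal fun v => termVal g (f v) := by
  funext x
  rcases x with c | v <;> simp [termVal]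

theorem termVal_inr (x : Value) : termVal Sum.inr x = x := by
  rcases x with c | v <;> simp [termVal]

theorem termVal_id : termVal Sum.inr = fun x => x := funext termVal_inr

theorem map_termVal (g f : ℕ → Value) (a : Atom Term) :
    Atom.map (termVal g) (Atom.map (termVal f) a) =
      Atom.map (termVal fun v => termVal g (f v)) a := by
  rw [Atom.map_map, termVal_comp]

theorem mem_varsOf {L : List (Atom Term)} {v : ℕ} :
    v ∈ varsOf L ↔ ∃ a ∈ L, Sum.inr v ∈ Atom.args a := by
  simp only [varsOf, List.mem_toFinset, List.mem_filterMap, List.mem_flatMap]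
  constructor
  · rintro ⟨t, ⟨a, ha, hta⟩, ht⟩
    rcases t with c | w
    · simp at ht
    · simp only [Sum.getRight?_inr, Option.some.injEq] at ht
      exact ⟨a, ha, ht ▸ hta⟩
  · rintro ⟨a, ha, hv⟩
    exact ⟨_, ⟨a, ha, hv⟩, rfl⟩

theorem map_termVal_congr {f g : ℕ → Value} {L : List (Atom Term)}
    (h : ∀ v ∈ varsOf L, f v = g v) {a : Atom Term} (ha : a ∈ L) :
    Atom.map (termVal f) a = Atom.map (termVal g) a := by
  refine Atom.map_congr fun x hx => ?_
  rcases x with c | v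
  · rfl
  · exact h v (mem_varsOf.2 ⟨a, ha, hx⟩)

theorem MapsInto.congr {f g : ℕ → Value} {L : List (Atom Term)} {I : Instance}
    (hf : MapsInto f L I) (h : ∀ v ∈ varsOf L, f v = g v) : MapsInto g L I := fun a ha => by
  rw [← map_termVal_congr h ha]
  exact hf a ha

theorem MapsInto.mono {f : ℕ → Value} {L : List (Atom Term)} {I J : Instance}
    (hf : MapsInto f L I) (h : I ⊆ J) : MapsInto f L J := fun a ha => h (hf a ha)

/-- `φ`, extended by the identity on constants, maps the atoms of `I` into `J`. -/
def Sends (φ : ℕ → Value) (I J : Instance) : Prop :=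
  ∀ a ∈ I, Atom.map (termVal φ) a ∈ J

/-- There is a homomorphism from `I` to `J`. -/
def HomTo (I J : Instance) : Prop := ∃ φ, Sends φ I J

theorem Sends.comp {φ ψ : ℕ → Value} {I J K : Instance} (hφ : Sends φ I J) (hψ : Sends ψ J K) :
    Sends (fun v => termVal ψ (φ v)) I K := fun a ha => by
  rw [← map_termVal]
  exact hψ _ (hφ a ha)

theorem Sends.mapsInto {φ f : ℕ → Value} {I J : Instance} {L : List (Atom Term)}
    (hφ : Sends φ I J) (hf : MapsInto f L I) : MapsInto (fun v => termVal φ (f v)) L J :=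
  fun a ha => by
    rw [← map_termVal]
    exact hφ _ (hf a ha)

theorem HomTo.trans {I J K : Instance} : HomTo I J → HomTo J K → HomTo I K :=
  fun ⟨_, hφ⟩ ⟨_, hψ⟩ => ⟨_, hφ.comp hψ⟩

theorem HomTo.of_subset {I J : Instance} (h : I ⊆ J) : HomTo I J :=
  ⟨Sum.inr, fun a ha => by rw [termVal_id, Atom.map_id']; exact h ha⟩

theorem HomTo.refl (I : Instance) : HomTo I I := HomTo.of_subset subset_rfl

theorem IsHom.eq_termVal {h : Value → Value} {I J : Instance} (hh : IsHom h I J) :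
    h = termVal fun n => h (Sum.inr n) := by
  funext x
  rcases x with c | n
  · exact hh.1 c
  · rfl

theorem IsHom.sends {h : Value → Value} {I J : Instance} (hh : IsHom h I J) :
    Sends (fun n => h (Sum.inr n)) I J := fun a ha => by
  rw [← hh.eq_termVal]
  exact hh.2 (Finset.mem_image_of_mem _ ha)

theorem Sends.isHom {φ : ℕ → Value} {I J : Instance} (h : Sends φ I J) :
    IsHom (termVal φ) I J :=
  ⟨fun _ => rfl, fun a ha => by
    obtain ⟨b, hb, rfl⟩ := Finset.mem_image.1 ha
    exact h b hb⟩

/-- All tgds of `S` hold in `U`. -/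
def Model (S : Finset TGD) (U : Instance) : Prop :=
  ∀ ξ ∈ S, ∀ f, MapsInto f (TGD.body ξ) U →
    ∃ g, (∀ v ∈ varsOf (TGD.body ξ), g v = f v) ∧ MapsInto g (TGD.head ξ) U

/-- The trigger obtained from an assignment that is defined on all variables. -/
def PreTrigger.ofFun (ξ : TGD) (f : ℕ → Value) : PreTrigger := ⟨ξ, fun v => f v⟩

theorem PreTrigger.extend_of_mem {t : PreTrigger} {g : ℕ → Value} {v : ℕ}
    (hv : v ∈ varsOf (TGD.body t.1)) : PreTrigger.extend t g v = t.2 ⟨v, hv⟩ := by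
  simp [PreTrigger.extend, hv]

theorem PreTrigger.extend_of_notMem {t : PreTrigger} {g : ℕ → Value} {v : ℕ}
    (hv : v ∉ varsOf (TGD.body t.1)) : PreTrigger.extend t g v = g v := by
  simp [PreTrigger.extend, hv]

theorem PreTrigger.extend_ofFun {ξ : TGD} {f g : ℕ → Value} {v : ℕ}
    (hv : v ∈ varsOf (TGD.body ξ)) :
    PreTrigger.extend (PreTrigger.ofFun ξ f) g v = f v :=
  PreTrigger.extend_of_mem (t := PreTrigger.ofFun ξ f) hv

theorem isTrigger_ofFun {S : Finset TGD} {I : Instance} {ξ : TGD} {f : ℕ → Value} (hξ : ξ ∈ S)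
    (hf : MapsInto f (TGD.body ξ) I) : IsTrigger S I (PreTrigger.ofFun ξ f) :=
  ⟨hξ, fun _ => hf.congr fun _ hv => (PreTrigger.extend_ofFun hv).symm⟩

theorem isActive_or_exists {S : Finset TGD} {I : Instance} {ξ : TGD} {f : ℕ → Value} (hξ : ξ ∈ S)
    (hf : MapsInto f (TGD.body ξ) I) : IsActive S I (PreTrigger.ofFun ξ f) ∨
      ∃ g, (∀ v ∈ varsOf (TGD.body ξ), g v = f v) ∧ MapsInto g (TGD.head ξ) I := by
  by_cases h : ∃ g, MapsInto (PreTrigger.extend (PreTrigger.ofFun ξ f) g) (TGD.head ξ) I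
  · obtain ⟨g, hg⟩ := h
    exact Or.inr ⟨_, fun v hv => PreTrigger.extend_ofFun hv, hg⟩
  · exact Or.inl ⟨isTrigger_ofFun hξ hf, h⟩

theorem model_of_forall_not_isActive {S : Finset TGD} {I : Instance} (h : ∀ t, ¬ IsActive S I t) :
    Model S I := fun _ hξ _ hf =>
  (isActive_or_exists hξ hf).resolve_left (h _)

theorem Model.not_isActive {S : Finset TGD} {I : Instance} (h : Model S I) (t : PreTrigger) :
    ¬ IsActive S I t := by
  rintro ⟨⟨hS, ht⟩, hn⟩
  obtain ⟨g, hg, hgI⟩ := h t.1 hS _ (ht fun _ => Sum.inl 0)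
  refine hn ⟨g, hgI.congr fun v _ => ?_⟩
  by_cases hv : v ∈ varsOf (TGD.body t.1)
  · rw [PreTrigger.extend_of_mem hv, hg v hv, PreTrigger.extend_of_mem hv]
  · rw [PreTrigger.extend_of_notMem hv]

/-! ### Derivations -/

/-- All nulls of `I` are smaller than `N`. -/
def NullsBelow (N : ℕ) (I : Instance) : Prop :=
  ∀ a ∈ I, ∀ n, Sum.inr n ∈ Atom.args a → n < N

theorem exists_nullsBelow (I : Instance) : ∃ N, NullsBelow N I := by
  refine ⟨(I.sup fun a => ((Atom.args a).map (Sum.elim (fun _ => 0) id)).sum) + 1,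
    fun a ha n hn => Nat.lt_succ_of_le ?_⟩
  refine le_trans ?_ (Finset.le_sup (f := fun a : Atom Value =>
    ((Atom.args a).map (Sum.elim (fun _ => 0) id)).sum) ha)
  exact List.single_le_sum (by simp) n (List.mem_map.2 ⟨_, hn, rfl⟩)

/-- The assignment that agrees with `f` on the body of `ξ` and gives the null `N + v` to every other
variable `v`. -/
def freshExt (ξ : TGD) (f : ℕ → Value) (N : ℕ) (v : ℕ) : Value :=
  if v ∈ varsOf (TGD.body ξ) then f v else Sum.inr (N + v)

/-- The atoms added when the trigger `(ξ, f)` is fired with nulls above `N`. -/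
def fired (ξ : TGD) (f : ℕ → Value) (N : ℕ) : Instance :=
  ((TGD.head ξ).map (Atom.map (termVal (freshExt ξ f N)))).toFinset

theorem mem_fired {ξ : TGD} {f : ℕ → Value} {N : ℕ} {a : Atom Value} :
    a ∈ fired ξ f N ↔ ∃ b ∈ TGD.head ξ, Atom.map (termVal (freshExt ξ f N)) b = a := by
  simp [fired]

/-- The instances obtained from `I` by firing triggers of `S`, active or not, one at a time. -/
inductive Deriv (S : Finset TGD) (I : Instance) : Instance → Prop
  | refl : Deriv S I I
  | step {J : Instance} (ξ : TGD) (f : ℕ → Value) (N : ℕ) (hJ : Deriv S I J) (hξ : ξ ∈ S)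
      (hf : MapsInto f (TGD.body ξ) J) (hN : NullsBelow N J) : Deriv S I (J ∪ fired ξ f N)

theorem Deriv.subset {S : Finset TGD} {I J : Instance} (h : Deriv S I J) : I ⊆ J := by
  induction h with
  | refl => exact subset_rfl
  | step ξ f N _ _ _ _ ih => exact ih.trans Finset.subset_union_left

theorem freshExt_of_mem {ξ : TGD} {f : ℕ → Value} {N v : ℕ} (hv : v ∈ varsOf (TGD.body ξ)) :
    freshExt ξ f N v = f v := if_pos hv

/-- Old and new nulls are separated by the bound `N`, so `φ` on `J` and the head assignment `e` can
be glued into one homomorphism. -/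
theorem homTo_union_fired {J M : Instance} {ξ : TGD} {f φ e : ℕ → Value} {N : ℕ}
    (hφ : Sends φ J M) (hf : MapsInto f (TGD.body ξ) J) (hN : NullsBelow N J)
    (he : ∀ v ∈ varsOf (TGD.body ξ), e v = termVal φ (f v))
    (heM : MapsInto e (TGD.head ξ) M) : HomTo (J ∪ fired ξ f N) M := by
  -- The null `N + v` was created for the variable `v`, hence the shift by `N`.
  refine ⟨fun n => if n < N then φ n else e (n - N), fun a ha => ?_⟩
  have key : ∀ a ∈ J, ∀ x ∈ Atom.args a,
      termVal (fun n => if n < N then φ n else e (n - N)) x = termVal φ x := by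
    intro a ha x hx
    rcases x with c | n
    · rfl
    · simp [termVal, hN a ha n hx]
  rcases Finset.mem_union.1 ha with ha | ha
  · rw [Atom.map_congr (key a ha)]
    exact hφ a ha
  · obtain ⟨b, hb, rfl⟩ := mem_fired.1 ha
    rw [map_termVal]
    have := heM b hb
    convert this using 1
    refine Atom.map_congr fun x hx => ?_
    rcases x with c | v
    · rfl
    · simp only [termVal, Sum.elim_inr, freshExt]
      split_ifs with hv
      · rw [he v hv]
        obtain ⟨b', hb', hvb⟩ := mem_varsOf.1 hv
        refine key _ (hf b' hb') _ ?_
        rw [Atom.args_map]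
        exact List.mem_map.2 ⟨_, hvb, rfl⟩
      · simp

/-- Universality of derived instances: a model already contains a head for the image of each fired
trigger. -/
theorem Deriv.homTo_model {S : Finset TGD} {I J U : Instance} (h : Deriv S I J) (hI : HomTo I U)
    (hU : Model S U) : HomTo J U := by
  induction h with
  | refl => exact hI
  | step ξ f N _ hξ hf hN ih =>
    obtain ⟨φ, hφ⟩ := ih
    obtain ⟨g, hg, hgU⟩ := hU ξ hξ _ (hφ.mapsInto hf)
    exact homTo_union_fired hφ hf hN hg hgU

/-- Triggers remain triggers as the instance grows, and `Deriv` does not require activity, so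
finitely many triggers can be fired in sequence. This simulates a parallel step. -/
theorem Deriv.exists_fired {S : Finset TGD} {I J : Instance} (h : Deriv S I J)
    (T : List (TGD × (ℕ → Value)))
    (hT : ∀ t ∈ T, t.1 ∈ S ∧ MapsInto t.2 (TGD.body t.1) J) :
    ∃ J', Deriv S I J' ∧ J ⊆ J' ∧ ∀ t ∈ T, ∃ e, (∀ v ∈ varsOf (TGD.body t.1), e v = t.2 v) ∧
      MapsInto e (TGD.head t.1) J' := by
  induction T with
  | nil => exact ⟨J, h, subset_rfl, by simp⟩
  | cons t T ih =>
    obtain ⟨J', hd, hs, hJ'⟩ := ih fun t ht => hT t (List.mem_cons_of_mem _ ht)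
    obtain ⟨hξ, hf⟩ := hT t List.mem_cons_self
    obtain ⟨N, hN⟩ := exists_nullsBelow J'
    refine ⟨J' ∪ fired t.1 t.2 N, hd.step t.1 t.2 N hξ (hf.mono hs) hN,
      hs.trans Finset.subset_union_left, ?_⟩
    simp only [List.mem_cons, forall_eq_or_imp]
    refine ⟨⟨freshExt t.1 t.2 N, fun v hv => freshExt_of_mem hv, fun a ha =>
      Finset.mem_union_right _ (mem_fired.2 ⟨a, ha, rfl⟩)⟩, fun t' ht' => ?_⟩
    obtain ⟨e, he, heJ⟩ := hJ' t' ht'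
    exact ⟨e, he, heJ.mono Finset.subset_union_left⟩

/-! ### Steps of the core chase -/

theorem finite_isTrigger (S : Finset TGD) (I : Instance) : {t | IsTrigger S I t}.Finite := by
  classical
  let A : Finset Value := I.biUnion fun a => (Atom.args a).toFinset
  have hfin : (⋃ ξ ∈ S, (fun h => (⟨ξ, h⟩ : PreTrigger)) ''
      (Set.univ.pi fun _ : varsOf (TGD.body ξ) => (A : Set Value))).Finite :=
    S.finite_toSet.biUnion fun ξ _ => (Set.Finite.pi fun _ => A.finite_toSet).image _
  refine hfin.subset ?_
  rintro ⟨ξ, h⟩ ⟨hξ, ht⟩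
  simp only [Set.mem_iUnion]
  refine ⟨ξ, hξ, h, fun v _ => ?_, rfl⟩
  obtain ⟨a, ha, hva⟩ := mem_varsOf.1 v.2
  have := ht (fun _ => Sum.inl 0) a ha
  simp only [A, Finset.coe_biUnion, Set.mem_iUnion]
  refine ⟨_, this, ?_⟩
  rw [Finset.mem_coe, List.mem_toFinset, Atom.args_map]
  refine List.mem_map.2 ⟨_, hva, ?_⟩
  simp only [termVal, Sum.elim_inr]
  exact PreTrigger.extend_of_mem (t := ⟨ξ, h⟩) v.2

theorem exists_isFresh (S : Finset TGD) (I : Instance) : ∃ ν, IsFresh S I ν := by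
  obtain ⟨N, hN⟩ := exists_nullsBelow I
  obtain ⟨e, he⟩ := exists_injective_nat PreTrigger
  refine ⟨fun t z => N + Nat.pair (e t) z, fun t _ z _ a ha hn => ?_, fun t _ z _ t' _ z' _ h => ?_⟩
  · exact absurd (hN a ha _ hn) (Nat.not_lt.2 (Nat.le_add_right _ _))
  · have := Nat.pair_eq_pair.1 (Nat.add_left_cancel h)
    exact ⟨he this.1, this.2⟩

theorem exists_isParallelFiring (S : Finset TGD) (I : Instance) (ν : PreTrigger → ℕ → ℕ) :
    ∃ K, IsParallelFiring S I ν K := by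
  have hfin : {t | IsActive S I t}.Finite := (finite_isTrigger S I).subset fun t ht => ht.1
  have h2 : ({a | a ∈ I} ∪ ⋃ t ∈ {t | IsActive S I t}, (fun b =>
      Atom.map (termVal (PreTrigger.extend t fun z => Sum.inr (ν t z))) b) ''
        {b | b ∈ TGD.head t.1}).Finite :=
    I.finite_toSet.union (hfin.biUnion fun t _ => (List.finite_toSet _).image _)
  refine ⟨h2.toFinset, fun a => ?_⟩
  simp only [Set.Finite.mem_toFinset, Set.mem_union, Set.mem_iUnion, Set.mem_image,
    Set.mem_ofPred_eq, exists_prop]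
  refine or_congr Iff.rfl (exists_congr fun t => and_congr Iff.rfl (exists_congr fun b =>
    and_congr Iff.rfl eq_comm))

theorem exists_isCore (I : Instance) : ∃ C, IsCore C I := by
  classical
  have hne : (I.powerset.filter fun C => HomTo I C).Nonempty :=
    ⟨I, by simp [HomTo.refl]⟩
  -- A core is a subset of least cardinality that receives a homomorphism from `I`.
  obtain ⟨C, hC, hmin⟩ := Finset.exists_min_image _ Finset.card hne
  simp only [Finset.mem_filter, Finset.mem_powerset] at hC hmin
  obtain ⟨hCI, φ, hφ⟩ := hC
  refine ⟨C, hCI, ⟨_, hφ.isHom⟩, ?_⟩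
  rintro ⟨g, hg, hlt⟩
  have hsend : Sends (fun n => g (Sum.inr n)) C (C.image (Atom.map g)) := fun a ha => by
    rw [← hg.eq_termVal]
    exact Finset.mem_image_of_mem _ ha
  have := hmin _ ⟨hlt.1.trans hCI, _, hφ.comp hsend⟩
  exact absurd (Finset.card_lt_card hlt) (by omega)

theorem exists_coreStep {S : Finset TGD} {I : Instance} (h : ∃ t, IsActive S I t) :
    ∃ J, CoreStep S I J := by
  obtain ⟨ν, hν⟩ := exists_isFresh S I
  obtain ⟨K, hK⟩ := exists_isParallelFiring S I ν
  obtain ⟨C, hC⟩ := exists_isCore K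
  exact ⟨C, h, ν, K, hν, hK, hC⟩

/-- Freshness is used twice: a new null determines its trigger and variable, so its image can be
prescribed, and new nulls do not occur in `I`, so `φ` is not disturbed there. -/
theorem homTo_parallelFiring {S : Finset TGD} {I K M : Instance} {ν : PreTrigger → ℕ → ℕ}
    {φ : ℕ → Value} (hν : IsFresh S I ν) (hK : IsParallelFiring S I ν K) (hφ : Sends φ I M)
    (hM : ∀ t, IsActive S I t → ∃ e : ℕ → Value,
      (∀ v (hv : v ∈ varsOf (TGD.body t.1)), e v = termVal φ (t.2 ⟨v, hv⟩)) ∧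
        MapsInto e (TGD.head t.1) M) : HomTo K M := by
  classical
  choose! e he heM using hM
  let P : ℕ → PreTrigger × ℕ → Prop := fun n p =>
    IsActive S I p.1 ∧ p.2 ∈ TGD.exVars p.1.1 ∧ n = ν p.1 p.2
  let ψ : ℕ → Value := fun n => if h : ∃ p, P n p then e h.choose.1 h.choose.2 else φ n
  have hψν : ∀ t, IsActive S I t → ∀ z ∈ TGD.exVars t.1, ψ (ν t z) = e t z := by
    intro t ht z hz
    have hex : ∃ p, P (ν t z) p := ⟨(t, z), ht, hz, rfl⟩
    have hs := hex.choose_spec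
    obtain ⟨h1, h2⟩ := hν.2 t ht z hz _ hs.1 _ hs.2.1 hs.2.2
    simp only [ψ, dif_pos hex]
    rw [← h1, ← h2]
  have hψ : ∀ a ∈ I, ∀ x ∈ Atom.args a, termVal ψ x = termVal φ x := by
    intro a ha x hx
    rcases x with c | n
    · rfl
    · have : ¬ ∃ p, P n p := by
        rintro ⟨p, h1, h2, rfl⟩
        exact hν.1 _ h1 _ h2 a ha hx
      exact dif_neg this
  refine ⟨ψ, fun a ha => ?_⟩
  rcases (hK a).1 ha with ha | ⟨t, ht, b, hb, rfl⟩
  · rw [Atom.map_congr (hψ a ha)]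
    exact hφ a ha
  · rw [map_termVal]
    have := heM t ht b hb
    convert this using 1
    refine Atom.map_congr fun x hx => ?_
    rcases x with c | v
    · rfl
    · simp only [termVal, Sum.elim_inr]
      by_cases hv : v ∈ varsOf (TGD.body t.1)
      · rw [PreTrigger.extend_of_mem hv, he t ht v hv]
        obtain ⟨b', hb', hvb⟩ := mem_varsOf.1 hv
        refine hψ _ (ht.1.2 (fun _ => Sum.inl 0) b' hb') _ ?_
        rw [Atom.args_map]
        refine List.mem_map.2 ⟨_, hvb, ?_⟩
        simp only [termVal, Sum.elim_inr]
        exact PreTrigger.extend_of_mem hv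
      · rw [PreTrigger.extend_of_notMem hv]
        exact hψν t ht v (Finset.mem_sdiff.2 ⟨mem_varsOf.2 ⟨b, hb, hx⟩, hv⟩)

theorem IsParallelFiring.subset {S : Finset TGD} {I K : Instance} {ν : PreTrigger → ℕ → ℕ}
    (hK : IsParallelFiring S I ν K) : I ⊆ K := fun a ha => (hK a).2 (Or.inl ha)

theorem IsCore.homTo {C I : Instance} (h : IsCore C I) : HomTo I C :=
  let ⟨_, hh⟩ := h.2.1
  ⟨_, hh.sends⟩

theorem CoreStep.homTo {S : Finset TGD} {I J : Instance} (h : CoreStep S I J) : HomTo I J := by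
  obtain ⟨_, ν, K, _, hK, hC⟩ := h
  exact (HomTo.of_subset hK.subset).trans hC.homTo

theorem CoreStep.homTo_model {S : Finset TGD} {I J U : Instance} (h : CoreStep S I J)
    (hI : HomTo I U) (hU : Model S U) : HomTo J U := by
  obtain ⟨_, ν, K, hν, hK, hC⟩ := h
  obtain ⟨φ, hφ⟩ := hI
  refine (HomTo.of_subset hC.1).trans (homTo_parallelFiring hν hK hφ fun t ht => ?_)
  obtain ⟨g, hg, hgU⟩ := hU t.1 ht.1.1 _ (hφ.mapsInto (ht.1.2 fun _ => Sum.inl 0))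
  exact ⟨g, fun v hv => by rw [hg v hv, PreTrigger.extend_of_mem hv], hgU⟩

/-- The active triggers on `A` are carried to `D` by the homomorphism. Their images may be inactive
in `D`, but are fired anyway. -/
theorem CoreStep.exists_deriv {S : Finset TGD} {I A B D : Instance} (h : CoreStep S A B)
    (hD : Deriv S I D) (hA : HomTo A D) : ∃ D', Deriv S I D' ∧ HomTo B D' := by
  obtain ⟨_, ν, K, hν, hK, hC⟩ := h
  obtain ⟨φ, hφ⟩ := hA
  have hfin : {t | IsActive S A t}.Finite := (finite_isTrigger S A).subset fun t ht => ht.1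
  obtain ⟨D', hD', hs, hf⟩ := hD.exists_fired (hfin.toFinset.toList.map fun t =>
    (t.1, fun v => termVal φ (PreTrigger.extend t (fun _ => Sum.inl 0) v))) (by
      intro p hp
      obtain ⟨t, ht, rfl⟩ := List.mem_map.1 hp
      have ht : IsActive S A t := by simpa using ht
      exact ⟨ht.1.1, hφ.mapsInto (ht.1.2 _)⟩)
  refine ⟨D', hD', (HomTo.of_subset hC.1).trans
    (homTo_parallelFiring hν hK (φ := φ) (fun a ha => hs (hφ a ha)) fun t ht => ?_)⟩
  obtain ⟨e, he, heD⟩ := hf _ (List.mem_map.2 ⟨t, by simpa using ht, rfl⟩)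
  exact ⟨e, fun v hv => (he v hv).trans (by simp only [PreTrigger.extend_of_mem hv]), heD⟩

/-- The chase is fair: the image of a trigger in `s m` is either already satisfied there or fired in
the next step. One chase step thus absorbs one derivation step. -/
theorem Deriv.exists_homTo {S : Finset TGD} {I J : Instance} (h : Deriv S I J)
    {s : ℕ → Instance} (h0 : s 0 = I) (hs : ∀ n, CoreStep S (s n) (s (n + 1))) :
    ∃ m, HomTo J (s m) := by
  induction h with
  | refl => exact ⟨0, h0 ▸ HomTo.refl _⟩
  | step ξ f N _ hξ hf hN ih =>
    obtain ⟨m, φ, hφ⟩ := ih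
    refine ⟨m + 1, ?_⟩
    obtain ⟨_, ν, K, hν, hK, hC⟩ := hs m
    refine HomTo.trans ?_ hC.homTo
    have hφK : Sends φ _ K := fun a ha => hK.subset (hφ a ha)
    rcases isActive_or_exists hξ (hφ.mapsInto hf) with ha | ⟨g, hg, hgI⟩
    · refine homTo_union_fired (e := PreTrigger.extend _ fun z => Sum.inr (ν (PreTrigger.ofFun ξ
        fun v => termVal φ (f v)) z)) hφK hf hN (fun v hv => PreTrigger.extend_ofFun hv) ?_
      exact fun a haa => (hK _).2 (Or.inr ⟨_, ha, a, haa, rfl⟩)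
    · exact homTo_union_fired hφK hf hN hg (hgI.mono hK.subset)

/-- A core that is homomorphically equivalent to a model is a model. -/
theorem IsCore.model {S : Finset TGD} {C K U : Instance} (hC : IsCore C K) (hU : Model S U)
    (h1 : HomTo C U) (h2 : HomTo U C) : Model S C := by
  obtain ⟨φ, hφ⟩ := h1
  obtain ⟨ψ, hψ⟩ := h2
  have hmaps := hφ.comp hψ
  set θ : ℕ → Value := fun v => termVal ψ (φ v) with hθ
  -- The round trip `θ` from `C` through `U` and back is an endomorphism of a core, hence permutes
  -- its finitely many atoms.
  have himg : C.image (Atom.map (termVal θ)) = C := by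
    by_contra hne
    exact hC.2.2 ⟨_, hmaps.isHom, lt_of_le_of_ne hmaps.isHom.2 hne⟩
  let F : C → C := fun a => ⟨Atom.map (termVal θ) a, hmaps a a.2⟩
  have hsurj : Function.Surjective F := by
    rintro ⟨b, hb⟩
    rw [← himg] at hb
    obtain ⟨a, ha, rfl⟩ := Finset.mem_image.1 hb
    exact ⟨⟨a, ha⟩, rfl⟩
  let σ : Equiv.Perm C := Equiv.ofBijective F (Finite.surjective_iff_bijective.1 hsurj)
  have hiter : ∀ k : ℕ, ∃ χ : ℕ → Value, ∀ a : C, ((σ ^ k) a : Atom Value) =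
      Atom.map (termVal χ) a := by
    intro k
    induction k with
    | zero => exact ⟨Sum.inr, fun a => by rw [termVal_id, Atom.map_id']; rfl⟩
    | succ k ih =>
      obtain ⟨χ, hχ⟩ := ih
      refine ⟨fun v => termVal χ (θ v), fun a => ?_⟩
      rw [pow_succ, Equiv.Perm.mul_apply, hχ, ← map_termVal]
      rfl
  -- The power `k` of `σ` is its inverse and is again induced by a homomorphism `χ`. Thus `χ` after
  -- `ψ` retracts `U` onto `C`, and heads found in `U` can be pulled back without moving the body.
  obtain ⟨k, hk⟩ : ∃ k, orderOf σ = k + 1 :=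
    Nat.exists_eq_succ_of_ne_zero (orderOf_pos σ).ne'
  obtain ⟨χ, hχ⟩ := hiter k
  have hfix : ∀ a ∈ C, Atom.map (termVal fun v => termVal χ (θ v)) a = a := by
    intro a ha
    have h1 : (σ ^ (k + 1)) ⟨a, ha⟩ = ⟨a, ha⟩ := by rw [← hk, pow_orderOf_eq_one]; rfl
    rw [pow_succ, Equiv.Perm.mul_apply] at h1
    have h2 := congrArg Subtype.val h1
    rw [hχ] at h2
    rw [← map_termVal]
    exact h2
  have hχC : Sends χ C C := fun a ha => by
    rw [← hχ ⟨a, ha⟩]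
    exact Subtype.prop _
  intro ξ hξ f hf
  obtain ⟨g, hg, hgU⟩ := hU ξ hξ _ (hφ.mapsInto hf)
  refine ⟨fun v => termVal χ (termVal ψ (g v)), fun v hv => ?_,
    hχC.mapsInto (hψ.mapsInto hgU)⟩
  simp only [hg v hv]
  obtain ⟨b, hb, hvb⟩ := mem_varsOf.1 hv
  have h1 := Atom.map_injOn ((hfix _ (hf b hb)).trans (Atom.map_id' _).symm) (f v) (by
    rw [Atom.args_map]; exact List.mem_map.2 ⟨_, hvb, rfl⟩)
  rw [← termVal_comp, hθ, ← termVal_comp] at h1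
  exact h1

/-- The core chase terminates if and only if there is a finite universal model. -/
theorem coreChaseTerminates_iff {S : Finset TGD} {I : Instance} :
    CoreChaseTerminates S I ↔ ∃ J U, Deriv S I J ∧ HomTo U J ∧ HomTo I U ∧ Model S U := by
  constructor
  · intro h
    by_contra hno
    apply h
    -- An instance with this invariant and no active trigger would itself be a finite universal
    -- model.
    let P : Instance → Prop := fun A => HomTo I A ∧ ∃ D, Deriv S I D ∧ HomTo A D
    have hstep : ∀ A : {A // P A}, ∃ B : {B // P B}, CoreStep S A B := by
      rintro ⟨A, hIA, D, hD, hAD⟩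
      have : ∃ t, IsActive S A t := by
        by_contra hna
        exact hno ⟨D, A, hD, hAD, hIA, model_of_forall_not_isActive (not_exists.1 hna)⟩
      obtain ⟨B, hB⟩ := exists_coreStep this
      exact ⟨⟨B, hIA.trans hB.homTo, hB.exists_deriv hD hAD⟩, hB⟩
    choose nxt hnxt using hstep
    let s : ℕ → {A // P A} := fun n =>
      nxt^[n] ⟨I, HomTo.refl I, I, Deriv.refl, HomTo.refl I⟩
    refine ⟨fun n => s n, rfl, fun n => ?_⟩
    have : s (n + 1) = nxt (s n) := Function.iterate_succ_apply' _ _ _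
    simp only [this]
    exact hnxt _
  · rintro ⟨J, U, hJ, hUJ, hIU, hU⟩ ⟨s, h0, hs⟩
    obtain ⟨m, hm⟩ := hJ.exists_homTo h0 hs
    have hsU : ∀ n, HomTo (s n) U := by
      intro n
      induction n with
      | zero => rwa [h0]
      | succ n ih => exact (hs n).homTo_model ih hU
    obtain ⟨_, ν, K, hν, hK, hC⟩ := hs m
    -- `s m` need not be a core when `m = 0`, so the argument uses the core `s (m + 1)`.
    have hmod := hC.model hU (hsU _) ((hUJ.trans hm).trans (hs m).homTo)
    obtain ⟨t, ht⟩ := (hs (m + 1)).1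
    exact hmod.not_isActive t ht

end CoreChase

/-! ### Recursive enumerability through primitive recursive certificates. -/

namespace CoreChase

/-! ### Primitive recursive predicates -/

section Primrec

variable {α β γ T U : Type} [Primcodable α] [Primcodable β] [Primcodable γ] [Primcodable T]
  [Primcodable U]

theorem primrecPred_forall_mem {L : β → List α} {R : β → α → Prop} (hL : Primrec L)
    (hR : PrimrecPred fun p : β × α => R p.1 p.2) : PrimrecPred fun b => ∀ a ∈ L b, R b a := by
  have h : PrimrecRel fun (a : α) (b : β) => R b a :=
    hR.comp (Primrec.pair Primrec.snd Primrec.fst)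
  exact h.forall_mem_list.comp hL Primrec.id

theorem primrecPred_exists_mem {L : β → List α} {R : β → α → Prop} (hL : Primrec L)
    (hR : PrimrecPred fun p : β × α => R p.1 p.2) : PrimrecPred fun b => ∃ a ∈ L b, R b a := by
  have h : PrimrecRel fun (a : α) (b : β) => R b a :=
    hR.comp (Primrec.pair Primrec.snd Primrec.fst)
  exact h.exists_mem_list.comp hL Primrec.id

theorem primrecPred_mem {L : β → List α} {f : β → α} (hf : Primrec f) (hL : Primrec L) :
    PrimrecPred fun b => f b ∈ L b := by
  have h : PrimrecPred fun b => ∃ a ∈ L b, f b = a :=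
    primrecPred_exists_mem hL
      (Primrec.eq.comp (hf.comp Primrec.fst) Primrec.snd)
  exact h.of_eq fun b => by simp

theorem primrecPred_imp {p q : α → Prop} (hp : PrimrecPred p) (hq : PrimrecPred q) :
    PrimrecPred fun a => p a → q a :=
  (hp.not.or hq).of_eq fun a => by tauto

theorem primrec_atom_map {g : β → T → U} {a : β → Atom T} (hg : Primrec₂ g) (ha : Primrec a) :
    Primrec fun x => Atom.map (g x) (a x) :=
  Primrec.pair (Primrec.fst.comp ha)
    (Primrec.pair (hg.comp Primrec.id (Primrec.fst.comp (Primrec.snd.comp ha)))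
      (Primrec.list_map (Primrec.snd.comp (Primrec.snd.comp ha)) hg))

theorem primrec_atom_args : Primrec (Atom.args : Atom T → List T) :=
  Primrec.list_cons.comp (Primrec.fst.comp Primrec.snd) (Primrec.snd.comp Primrec.snd)

/-- Search all natural numbers for the code of a witness. -/
theorem rePred_exists {p : α → β → Prop} (hp : PrimrecPred fun x : α × β => p x.1 x.2) :
    REPred fun a => ∃ b, p a b := by
  obtain ⟨_, hpr⟩ := hp
  have hd : ∀ a b, Decidable (p a b) := fun a b => inferInstanceAs (Decidable
    ((fun x : α × β => p x.1 x.2) (a, b)))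
  replace hpr : Primrec fun x : α × β => decide (p x.1 x.2) := hpr.of_eq fun x => by congr
  let f : α → ℕ → Option Unit := fun a n =>
    (Encodable.decode (α := β) n).bind fun b => bif decide (p a b) then some () else none
  have hf : Computable₂ f := by
    refine Primrec.to_comp ?_
    refine Primrec.option_bind (Primrec.decode.comp Primrec.snd) ?_
    refine Primrec.cond ?_ (Primrec.const _) (Primrec.const _)
    exact hpr.comp (Primrec.pair (Primrec.fst.comp Primrec.fst) Primrec.snd)
  have h := (Partrec.rfindOpt hf).dom_re
  refine h.of_eq fun a => ?_
  rw [Nat.rfindOpt_dom]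
  constructor
  · rintro ⟨n, u, hu⟩
    simp only [f, Option.mem_def, Option.bind_eq_some_iff] at hu
    obtain ⟨b, _, hb⟩ := hu
    refine ⟨b, ?_⟩
    by_contra hn
    simp [hn] at hb
  · rintro ⟨b, hb⟩
    exact ⟨Encodable.encode b, (), by simp [f, hb]⟩

end Primrec

/-! ### Certificates for termination -/

/-- The assignment given by a list of values. -/
def listVal (l : List Value) (n : ℕ) : Value := l.getD n (Sum.inl 0)

/-- All variables (or nulls) of `L` are smaller than `k`. -/
def IndicesBelow (k : ℕ) (L : List (Atom (ℕ ⊕ ℕ))) : Prop :=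
  ∀ a ∈ L, ∀ x ∈ Atom.args a, Sum.elim (fun _ => 0) Nat.succ x ≤ k

theorem indicesBelow_iff {k : ℕ} {L : List (Atom (ℕ ⊕ ℕ))} :
    IndicesBelow k L ↔ ∀ a ∈ L, ∀ n, Sum.inr n ∈ Atom.args a → n < k := by
  refine forall₂_congr fun a _ => ⟨fun h n hn => h _ hn, fun h x hx => ?_⟩
  rcases x with c | n
  · exact Nat.zero_le _
  · exact h n hx

/-- All tuples of length `k` over `L`. -/
def tuples (L : List Value) (k : ℕ) : List (List Value) :=
  Nat.rec [[]] (fun _ T => T.flatMap fun l => L.map fun x => x :: l) k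

theorem mem_tuples {L : List Value} {k : ℕ} {l : List Value} :
    l ∈ tuples L k ↔ l.length = k ∧ ∀ x ∈ l, x ∈ L := by
  induction k generalizing l with
  | zero =>
    change l ∈ [[]] ↔ _
    rw [List.mem_singleton, List.length_eq_zero_iff]
    exact ⟨fun h => ⟨h, by simp [h]⟩, fun h => h.1⟩
  | succ k ih =>
    change l ∈ (tuples L k).flatMap _ ↔ _
    simp only [List.mem_flatMap, List.mem_map]
    constructor
    · rintro ⟨l', hl', x, hx, rfl⟩
      obtain ⟨h1, h2⟩ := ih.1 hl'
      simp only [List.length_cons, h1, List.mem_cons, forall_eq_or_imp, true_and]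
      exact ⟨hx, h2⟩
    · rintro ⟨h1, h2⟩
      rcases l with _ | ⟨x, l⟩
      · simp at h1
      · simp only [List.mem_cons, forall_eq_or_imp] at h2
        exact ⟨l, ih.2 ⟨by simpa using h1, h2.2⟩, x, h2.1, rfl⟩

/-- The elements of `U`, and one constant. -/
def candidates (U : List (Atom Value)) : List Value := Sum.inl 0 :: U.flatMap Atom.args

/-- A bounded form of `Model`, for tgds with variables below `k`. -/
def BoundedModel (S : List TGD) (U : List (Atom Value)) (k : ℕ) : Prop :=
  ∀ ξ ∈ S, ∀ l ∈ tuples (candidates U) k,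
    (∀ a ∈ TGD.body ξ, Atom.map (termVal (listVal l)) a ∈ U) →
    ∃ l' ∈ tuples (candidates U) k,
      (∀ a ∈ TGD.body ξ, Atom.map (termVal (listVal l')) a = Atom.map (termVal (listVal l)) a) ∧
      ∀ a ∈ TGD.head ξ, Atom.map (termVal (listVal l')) a ∈ U

open Classical in
/-- Every assignment can be replaced by a tuple of candidates. -/
theorem exists_tuple (U : List (Atom Value)) (k : ℕ) (f : ℕ → Value) :
    ∃ l ∈ tuples (candidates U) k,
      ∀ n < k, f n ∈ candidates U → listVal l n = f n := by
  refine ⟨(List.range k).map fun n => if f n ∈ candidates U then f n else Sum.inl 0,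
    mem_tuples.2 ⟨by simp, fun x hx => ?_⟩, fun n hn hf => ?_⟩
  · obtain ⟨n, _, rfl⟩ := List.mem_map.1 hx
    split_ifs with h
    · exact h
    · exact List.mem_cons_self
  · simp [listVal, hn, hf]

theorem mem_candidates {U : List (Atom Value)} {L : List (Atom Term)} {f : ℕ → Value} {v : ℕ}
    (hf : ∀ a ∈ L, Atom.map (termVal f) a ∈ U) (hv : v ∈ varsOf L) : f v ∈ candidates U := by
  obtain ⟨a, ha, hva⟩ := mem_varsOf.1 hv
  refine List.mem_cons_of_mem _ (List.mem_flatMap.2 ⟨_, hf a ha, ?_⟩)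
  rw [Atom.args_map]
  exact List.mem_map.2 ⟨_, hva, rfl⟩

/-- A variable occurring in a conjunction that is mapped into `U` takes its value among the
arguments of `U`, so finitely many tuples represent all relevant assignments. Agreement on body
variables is expressed by equality of the images of body atoms. -/
theorem boundedModel_iff {S : List TGD} {U : List (Atom Value)} {k : ℕ}
    (hk : ∀ ξ ∈ S, IndicesBelow k (TGD.body ξ) ∧ IndicesBelow k (TGD.head ξ)) :
    BoundedModel S U k ↔ Model S.toFinset U.toFinset := by
  have below : ∀ {L : List (Atom Term)}, IndicesBelow k L → ∀ v ∈ varsOf L, v < k := by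
    intro L hL v hv
    obtain ⟨a, ha, hva⟩ := mem_varsOf.1 hv
    exact indicesBelow_iff.1 hL a ha v hva
  constructor
  · intro h ξ hξ f hf
    have hξ : ξ ∈ S := by simpa using hξ
    have hfU : ∀ a ∈ TGD.body ξ, Atom.map (termVal f) a ∈ U := fun a ha => by
      simpa using hf a ha
    obtain ⟨l, hl, hlf⟩ := exists_tuple U k f
    have hlb : ∀ v ∈ varsOf (TGD.body ξ), listVal l v = f v := fun v hv =>
      hlf v (below (hk ξ hξ).1 v hv) (mem_candidates hfU hv)
    obtain ⟨l', _, h1, h2⟩ := h ξ hξ l hl fun a ha => by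
      rw [map_termVal_congr hlb ha]
      exact hfU a ha
    refine ⟨listVal l', fun v hv => ?_, fun a ha => by simpa using h2 a ha⟩
    obtain ⟨a, ha, hva⟩ := mem_varsOf.1 hv
    rw [← hlb v hv]
    exact Atom.map_injOn (h1 a ha) (Sum.inr v) hva
  · intro h ξ hξ l hl hb
    obtain ⟨g, hg, hgU⟩ := h ξ (by simpa using hξ) (listVal l) fun a ha => by simpa using hb a ha
    have hgU' : ∀ a ∈ TGD.head ξ, Atom.map (termVal g) a ∈ U := fun a ha => by
      simpa using hgU a ha
    obtain ⟨l', hl', hlg⟩ := exists_tuple U k g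
    refine ⟨l', hl', fun a ha => map_termVal_congr (fun v hv => ?_) ha, fun a ha => ?_⟩
    · rw [← hg v hv]
      refine hlg v (below (hk ξ hξ).1 v hv) ?_
      rw [hg v hv]
      exact mem_candidates hb hv
    · rw [map_termVal_congr (fun v hv =>
        hlg v (below (hk ξ hξ).2 v hv) (mem_candidates hgU' hv)) ha]
      exact hgU' a ha

open Classical in
/-- The value of a term under the assignment `freshExt`. -/
noncomputable def freshTerm (ξ : TGD) (l : List Value) (N : ℕ) (t : Term) : Value :=
  Sum.casesOn t Sum.inl fun v =>
    if Sum.inr v ∈ (TGD.body ξ).flatMap Atom.args then listVal l v else Sum.inr (N + v)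

theorem freshTerm_eq (ξ : TGD) (l : List Value) (N : ℕ) :
    freshTerm ξ l N = termVal (freshExt ξ (listVal l) N) := by
  funext t
  rcases t with c | v
  · rfl
  · have h : Sum.inr v ∈ (TGD.body ξ).flatMap Atom.args ↔ v ∈ varsOf (TGD.body ξ) := by
      rw [mem_varsOf, List.mem_flatMap]
    simp only [freshTerm, termVal, Sum.elim_inr, freshExt, h]

/-- The condition for firing the trigger `(ξ, l)` on `J` with nulls above `N`. -/
def CanFire (S : List TGD) (J : List (Atom Value)) (t : TGD × List Value × ℕ) : Prop :=
  t.1 ∈ S ∧ (∀ a ∈ TGD.body t.1, Atom.map (termVal (listVal t.2.1)) a ∈ J) ∧ IndicesBelow t.2.2 J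

open Classical in
/-- Fire a trigger if possible. -/
noncomputable def fireOne (S : List TGD) (J : List (Atom Value)) (t : TGD × List Value × ℕ) :
    List (Atom Value) :=
  if CanFire S J t then J ++ (TGD.head t.1).map (Atom.map (freshTerm t.1 t.2.1 t.2.2)) else J

/-- Fire a list of triggers one after the other. -/
noncomputable def fireAll (S : List TGD) (I : List (Atom Value)) (T : List (TGD × List Value × ℕ)) :
    List (Atom Value) :=
  T.foldl (fireOne S) I

/-- Entries that cannot be fired are skipped, so every list, however ill-formed, describes a
derivation. -/
theorem deriv_fireAll (S : List TGD) (I : List (Atom Value)) (T : List (TGD × List Value × ℕ)) :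
    Deriv S.toFinset I.toFinset (fireAll S I T).toFinset := by
  induction T using List.reverseRecOn with
  | nil => exact Deriv.refl
  | append_singleton T t ih =>
    simp only [fireAll, List.foldl_append, List.foldl_cons, List.foldl_nil]
    change Deriv _ _ (fireOne S (fireAll S I T) t).toFinset
    unfold fireOne
    split_ifs with h
    · rw [List.toFinset_append, freshTerm_eq]
      refine ih.step t.1 (listVal t.2.1) t.2.2 (by simpa using h.1)
        (fun a ha => by simpa using h.2.1 a ha) fun a ha n hn => ?_
      exact indicesBelow_iff.1 h.2.2 a (by simpa using ha) n hn
    · exact ih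

theorem exists_listVal (f : ℕ → Value) (k : ℕ) : ∃ l, ∀ n < k, listVal l n = f n :=
  ⟨(List.range k).map f, fun n hn => by simp [listVal, hn]⟩

theorem exists_forall_lt_varsOf (L : List (Atom Term)) : ∃ k, ∀ v ∈ varsOf L, v < k :=
  ⟨(varsOf L).sup id + 1, fun _ hv => Nat.lt_succ_of_le (Finset.le_sup (f := id) hv)⟩

theorem Deriv.exists_fireAll {S : List TGD} {I : List (Atom Value)} {J : Instance}
    (h : Deriv S.toFinset I.toFinset J) : ∃ T, (fireAll S I T).toFinset = J := by
  induction h with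
  | refl => exact ⟨[], rfl⟩
  | step ξ f N _ hξ hf hN ih =>
    obtain ⟨T, rfl⟩ := ih
    obtain ⟨k, hk⟩ := exists_forall_lt_varsOf (TGD.body ξ)
    obtain ⟨l, hl⟩ := exists_listVal f k
    have hlb : ∀ v ∈ varsOf (TGD.body ξ), listVal l v = f v := fun v hv => hl v (hk v hv)
    refine ⟨T ++ [(ξ, l, N)], ?_⟩
    have hc : CanFire S (fireAll S I T) (ξ, l, N) :=
      ⟨by simpa using hξ, fun a ha => by
        rw [map_termVal_congr hlb ha]
        simpa using hf a ha, indicesBelow_iff.2 fun a ha n hn => hN a (by simpa using ha) n hn⟩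
    simp only [fireAll, List.foldl_append, List.foldl_cons, List.foldl_nil]
    change (fireOne S (fireAll S I T) (ξ, l, N)).toFinset = _
    rw [fireOne, if_pos hc, List.toFinset_append, fired, freshTerm_eq]
    have : freshExt ξ (listVal l) N = freshExt ξ f N := by
      funext v
      unfold freshExt
      split_ifs with hv
      · exact hlb v hv
      · rfl
    rw [this]
    rfl

/-- A list of triggers, the atoms of a universal model, two maps of nulls, and a bound for the
variables. -/
abbrev Certificate : Type :=
  List (TGD × List Value × ℕ) × List (Atom Value) × List Value × List Value × ℕ

/-- The certificate `c` shows that the core chase on `P.1` with `P.2` terminates. -/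
def Certifies (P : List (Atom Value) × List TGD) (c : Certificate) : Prop :=
  (∀ a ∈ P.1, Atom.map (termVal (listVal c.2.2.1)) a ∈ c.2.1) ∧
  (∀ a ∈ c.2.1, Atom.map (termVal (listVal c.2.2.2.1)) a ∈ fireAll P.2 P.1 c.1) ∧
  (∀ ξ ∈ P.2, IndicesBelow c.2.2.2.2 (TGD.body ξ) ∧ IndicesBelow c.2.2.2.2 (TGD.head ξ)) ∧
  BoundedModel P.2 c.2.1 c.2.2.2.2

theorem HomTo.exists_listVal {I J : Instance} (h : HomTo I J) : ∃ l, Sends (listVal l) I J := by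
  obtain ⟨φ, hφ⟩ := h
  obtain ⟨N, hN⟩ := exists_nullsBelow I
  obtain ⟨l, hl⟩ := CoreChase.exists_listVal φ N
  refine ⟨l, fun a ha => ?_⟩
  rw [Atom.map_congr (g := termVal φ)]
  · exact hφ a ha
  · intro x hx
    rcases x with c | n
    · rfl
    · exact hl n (hN a ha n hx)

theorem exists_indicesBelow (S : List TGD) :
    ∃ k, ∀ ξ ∈ S, IndicesBelow k (TGD.body ξ) ∧ IndicesBelow k (TGD.head ξ) := by
  obtain ⟨k, hk⟩ := exists_nullsBelow (S.flatMap fun ξ => ξ.1 ++ ξ.2).toFinset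
  refine ⟨k, fun ξ hξ => ⟨indicesBelow_iff.2 fun a ha => hk a ?_,
    indicesBelow_iff.2 fun a ha => hk a ?_⟩⟩
  · rw [List.mem_toFinset]
    exact List.mem_flatMap.2 ⟨ξ, hξ, List.mem_append_left _ ha⟩
  · rw [List.mem_toFinset]
    exact List.mem_flatMap.2 ⟨ξ, hξ, List.mem_append_right _ ha⟩

theorem exists_certifies_iff (P : List (Atom Value) × List TGD) :
    P.2.toFinset ∈ CTcore P.1.toFinset ↔ ∃ c, Certifies P c := by
  change CoreChaseTerminates _ _ ↔ _
  rw [coreChaseTerminates_iff]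
  constructor
  · rintro ⟨J, U, hJ, hUJ, hIU, hU⟩
    obtain ⟨T, rfl⟩ := hJ.exists_fireAll
    obtain ⟨p, hp⟩ := hIU.exists_listVal
    obtain ⟨q, hq⟩ := hUJ.exists_listVal
    obtain ⟨k, hk⟩ := exists_indicesBelow P.2
    -- Homomorphisms and assignments matter only on finitely many indices, so lists can replace
    -- them.
    refine ⟨(T, U.toList, p, q, k), fun a ha => ?_, fun a ha => ?_, hk, ?_⟩
    · exact Finset.mem_toList.2 (hp a (by simpa using ha))
    · exact List.mem_toFinset.1 (hq a (Finset.mem_toList.1 ha))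
    · exact (boundedModel_iff hk).2 (by rwa [Finset.toList_toFinset])
  · rintro ⟨⟨T, U, p, q, k⟩, h1, h2, h3, h4⟩
    exact ⟨_, U.toFinset, deriv_fireAll P.2 P.1 T,
      ⟨listVal q, fun a ha => List.mem_toFinset.2 (h2 a (List.mem_toFinset.1 ha))⟩,
      ⟨listVal p, fun a ha => List.mem_toFinset.2 (h1 a (List.mem_toFinset.1 ha))⟩,
      (boundedModel_iff h3).1 h4⟩

/-! ### Certificates can be checked -/

section Check

variable {β : Type} [Primcodable β]

theorem primrec_listVal {l : β → List Value} {n : β → ℕ} (hl : Primrec l) (hn : Primrec n) :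
    Primrec fun b => listVal (l b) (n b) :=
  (Primrec.list_getD _).comp hl hn

theorem primrec_map_listVal {l : β → List Value} {a : β → Atom (ℕ ⊕ ℕ)} (hl : Primrec l)
    (ha : Primrec a) : Primrec fun b => Atom.map (termVal (listVal (l b))) (a b) := by
  refine primrec_atom_map (g := fun b => termVal (listVal (l b))) ?_ ha
  have h : Primrec fun p : β × (ℕ ⊕ ℕ) =>
      (Sum.casesOn p.2 Sum.inl fun v => listVal (l p.1) v : Value) :=
    Primrec.sumCasesOn Primrec.snd (Primrec.sumInl.comp Primrec.snd).to₂
      (primrec_listVal (hl.comp (Primrec.fst.comp Primrec.fst)) Primrec.snd).to₂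
  refine h.of_eq fun p => ?_
  rcases p with ⟨b, c | v⟩ <;> rfl

theorem primrecPred_indicesBelow {k : β → ℕ} {L : β → List (Atom (ℕ ⊕ ℕ))} (hk : Primrec k)
    (hL : Primrec L) : PrimrecPred fun b => IndicesBelow (k b) (L b) := by
  refine primrecPred_forall_mem hL (primrecPred_forall_mem
    (primrec_atom_args.comp Primrec.snd) ?_)
  have h : Primrec fun p : (β × Atom (ℕ ⊕ ℕ)) × (ℕ ⊕ ℕ) =>
      (Sum.casesOn p.2 (fun _ => 0) fun n => n + 1 : ℕ) :=
    Primrec.sumCasesOn Primrec.snd (Primrec.const 0).to₂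
      (Primrec.succ.comp Primrec.snd).to₂
  refine Primrec.nat_le.comp (h.of_eq fun p => ?_)
    (hk.comp (Primrec.fst.comp Primrec.fst))
  rcases p with ⟨b, c | v⟩ <;> rfl

theorem primrec_tuples {L : β → List Value} {k : β → ℕ} (hL : Primrec L) (hk : Primrec k) :
    Primrec fun b => tuples (L b) (k b) := by
  have h1 : Primrec₂ fun (p : β × ℕ × List (List Value)) (l : List Value) =>
      (L p.1).map fun x => x :: l :=
    Primrec.list_map (hL.comp (Primrec.fst.comp Primrec.fst))
      (Primrec.list_cons.comp Primrec.snd (Primrec.snd.comp Primrec.fst)).to₂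
  have h2 : Primrec₂ fun (b : β) (p : ℕ × List (List Value)) =>
      p.2.flatMap fun l => (L b).map fun x => x :: l :=
    Primrec.list_flatMap (Primrec.snd.comp Primrec.snd) h1
  exact Primrec.nat_rec' hk (Primrec.const _) h2

theorem primrec_candidates : Primrec candidates :=
  Primrec.list_cons.comp (Primrec.const _)
    (Primrec.list_flatMap (g := fun _ => Atom.args) Primrec.id
      (primrec_atom_args.comp Primrec.snd).to₂)

theorem primrec_body : Primrec TGD.body := Primrec.fst

theorem primrec_head : Primrec TGD.head := Primrec.snd

theorem primrecPred_boundedModel {S : β → List TGD} {U : β → List (Atom Value)} {k : β → ℕ}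
    (hS : Primrec S) (hU : Primrec U) (hk : Primrec k) :
    PrimrecPred fun b => BoundedModel (S b) (U b) (k b) := by
  have ht : Primrec fun b => tuples (candidates (U b)) (k b) :=
    primrec_tuples (primrec_candidates.comp hU) hk
  refine primrecPred_forall_mem hS (primrecPred_forall_mem (ht.comp Primrec.fst)
    (primrecPred_imp ?_ (primrecPred_exists_mem
      (ht.comp (Primrec.fst.comp Primrec.fst)) (PrimrecPred.and ?_ ?_))))
  · refine primrecPred_forall_mem (primrec_body.comp (Primrec.snd.comp Primrec.fst))
      (primrecPred_mem (primrec_map_listVal (Primrec.snd.comp Primrec.fst) Primrec.snd)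
        (hU.comp (Primrec.fst.comp (Primrec.fst.comp Primrec.fst))))
  · refine primrecPred_forall_mem
      (primrec_body.comp (Primrec.snd.comp (Primrec.fst.comp Primrec.fst)))
      (Primrec.eq.comp (primrec_map_listVal (Primrec.snd.comp Primrec.fst) Primrec.snd)
        (primrec_map_listVal (Primrec.snd.comp (Primrec.fst.comp Primrec.fst)) Primrec.snd))
  · refine primrecPred_forall_mem
      (primrec_head.comp (Primrec.snd.comp (Primrec.fst.comp Primrec.fst)))
      (primrecPred_mem (primrec_map_listVal (Primrec.snd.comp Primrec.fst) Primrec.snd)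
        (hU.comp (Primrec.fst.comp (Primrec.fst.comp (Primrec.fst.comp Primrec.fst)))))

theorem primrec_freshTerm : Primrec fun p : (TGD × List Value × ℕ) × Term =>
    freshTerm p.1.1 p.1.2.1 p.1.2.2 p.2 := by
  classical
  refine Primrec.sumCasesOn (g := fun _ c => Sum.inl c) Primrec.snd
    (Primrec.sumInl.comp Primrec.snd).to₂ ?_
  refine Primrec.ite (primrecPred_mem (Primrec.sumInr.comp Primrec.snd)
    (Primrec.list_flatMap (primrec_body.comp
      (Primrec.fst.comp (Primrec.fst.comp Primrec.fst)))
      (primrec_atom_args.comp Primrec.snd))) ?_ ?_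
  · exact primrec_listVal (Primrec.fst.comp (Primrec.snd.comp (Primrec.fst.comp Primrec.fst)))
      Primrec.snd
  · exact Primrec.sumInr.comp (Primrec.nat_add.comp
      (Primrec.snd.comp (Primrec.snd.comp (Primrec.fst.comp Primrec.fst))) Primrec.snd)

theorem primrecPred_canFire :
    PrimrecPred fun p : (List TGD × List (Atom Value)) × (TGD × List Value × ℕ) =>
      CanFire p.1.1 p.1.2 p.2 := by
  refine PrimrecPred.and (primrecPred_mem (Primrec.fst.comp Primrec.snd)
    (Primrec.fst.comp Primrec.fst)) (PrimrecPred.and ?_ ?_)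
  · refine primrecPred_forall_mem (primrec_body.comp (Primrec.fst.comp Primrec.snd))
      (primrecPred_mem (primrec_map_listVal
        (Primrec.fst.comp (Primrec.snd.comp (Primrec.snd.comp Primrec.fst))) Primrec.snd)
        (Primrec.snd.comp (Primrec.fst.comp Primrec.fst)))
  · exact primrecPred_indicesBelow (Primrec.snd.comp (Primrec.snd.comp Primrec.snd))
      (Primrec.snd.comp Primrec.fst)

theorem primrec_fireOne :
    Primrec fun p : (List TGD × List (Atom Value)) × (TGD × List Value × ℕ) =>
      fireOne p.1.1 p.1.2 p.2 := by
  classical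
  have h : Primrec fun p : (List TGD × List (Atom Value)) × (TGD × List Value × ℕ) =>
      (TGD.head p.2.1).map (Atom.map (freshTerm p.2.1 p.2.2.1 p.2.2.2)) := by
    refine Primrec.list_map (primrec_head.comp (Primrec.fst.comp Primrec.snd)) ?_
    exact primrec_atom_map
      (g := fun (q : ((List TGD × List (Atom Value)) × (TGD × List Value × ℕ)) × Atom Term) t =>
        freshTerm q.1.2.1 q.1.2.2.1 q.1.2.2.2 t)
      (primrec_freshTerm.comp (Primrec.pair
        (Primrec.snd.comp (Primrec.fst.comp Primrec.fst)) Primrec.snd)) Primrec.snd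
  unfold fireOne
  exact Primrec.ite primrecPred_canFire (Primrec.list_append.comp
    (Primrec.snd.comp Primrec.fst) h) (Primrec.snd.comp Primrec.fst)

theorem primrec_fireAll {S : β → List TGD} {I : β → List (Atom Value)}
    {T : β → List (TGD × List Value × ℕ)} (hS : Primrec S) (hI : Primrec I) (hT : Primrec T) :
    Primrec fun b => fireAll (S b) (I b) (T b) := by
  refine Primrec.list_foldl (h := fun b p => fireOne (S b) p.1 p.2) hT hI ?_
  exact primrec_fireOne.comp (Primrec.pair (Primrec.pair (hS.comp Primrec.fst)
    (Primrec.fst.comp Primrec.snd)) (Primrec.snd.comp Primrec.snd))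

theorem primrecPred_certifies :
    PrimrecPred fun p : (List (Atom Value) × List TGD) × Certificate => Certifies p.1 p.2 := by
  have hI : Primrec fun p : (List (Atom Value) × List TGD) × Certificate => p.1.1 :=
    Primrec.fst.comp Primrec.fst
  have hS : Primrec fun p : (List (Atom Value) × List TGD) × Certificate => p.1.2 :=
    Primrec.snd.comp Primrec.fst
  have hT : Primrec fun p : (List (Atom Value) × List TGD) × Certificate => p.2.1 :=
    Primrec.fst.comp Primrec.snd
  have h1 : Primrec fun p : (List (Atom Value) × List TGD) × Certificate => p.2.2 :=
    Primrec.snd.comp Primrec.snd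
  have hU := Primrec.fst.comp h1
  have h2 := Primrec.snd.comp h1
  have hp := Primrec.fst.comp h2
  have h3 := Primrec.snd.comp h2
  have hq := Primrec.fst.comp h3
  have hk := Primrec.snd.comp h3
  refine PrimrecPred.and ?_ (PrimrecPred.and ?_ (PrimrecPred.and ?_ ?_))
  · exact primrecPred_forall_mem hI (primrecPred_mem
      (primrec_map_listVal (hp.comp Primrec.fst) Primrec.snd) (hU.comp Primrec.fst))
  · exact primrecPred_forall_mem hU (primrecPred_mem
      (primrec_map_listVal (hq.comp Primrec.fst) Primrec.snd)
      ((primrec_fireAll hS hI hT).comp Primrec.fst))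
  · exact primrecPred_forall_mem hS (PrimrecPred.and
      (primrecPred_indicesBelow (hk.comp Primrec.fst) (primrec_body.comp Primrec.snd))
      (primrecPred_indicesBelow (hk.comp Primrec.fst) (primrec_head.comp Primrec.snd)))
  · exact primrecPred_boundedModel hS hU hk

end Check

theorem rePred_pairs : REPred fun P : List (Atom Value) × List TGD =>
    P.2.toFinset ∈ CTcore P.1.toFinset :=
  (rePred_exists primrecPred_certifies).of_eq fun P => (exists_certifies_iff P).symm

theorem rePred_CTcore (I : Instance) : REPred fun S : List TGD => S.toFinset ∈ CTcore I := by
  have h : Computable fun S : List TGD => (I.toList, S) :=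
    Computable.pair (Computable.const _) Computable.id
  have h2 : REPred fun S : List TGD => S.toFinset ∈ CTcore I.toList.toFinset :=
    Partrec.comp rePred_pairs h
  rwa [Finset.toList_toFinset] at h2

end CoreChase

/-! ### A deterministic root-rewriting system that simulates computation. -/

namespace CoreChase

/-! ### Rewriting of binary trees at the root -/

/-- Binary trees with labelled leaves. -/
inductive Tr (α : Type) : Type
  | leaf (a : α)
  | node (l r : Tr α)
  deriving DecidableEq

/-- Patterns: binary trees whose leaves are constants (`Sum.inl`) or variables (`Sum.inr`). -/
abbrev Pat : Type := Tr Term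

namespace Tr

/-- Replace the variables of a pattern by trees. -/
def subst (σ : ℕ → Tr ℕ) : Pat → Tr ℕ
  | leaf (Sum.inl c) => leaf c
  | leaf (Sum.inr v) => σ v
  | node l r => node (subst σ l) (subst σ r)

/-- A tree as a pattern without variables. -/
def ground : Tr ℕ → Pat
  | leaf c => leaf (Sum.inl c)
  | node l r => node (ground l) (ground r)

/-- The list of all subpatterns other than constants. -/
def subs : Pat → List Pat
  | leaf (Sum.inl _) => []
  | leaf (Sum.inr v) => [leaf (Sum.inr v)]
  | node l r => node l r :: (subs l ++ subs r)

/-- `p` and `q` differ at a position where both have a constant or a node. -/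
def clash : Pat → Pat → Bool
  | leaf (Sum.inl c), leaf (Sum.inl d) => c != d
  | leaf (Sum.inl _), node _ _ => true
  | node _ _, leaf (Sum.inl _) => true
  | node a b, node c d => clash a c || clash b d
  | _, _ => false

/-- The substitutions are independent, so rules may share variable names. -/
theorem subst_ne_of_clash (σ τ : ℕ → Tr ℕ) : ∀ {p q : Pat}, clash p q → subst σ p ≠ subst τ q
  | leaf (Sum.inl c), leaf (Sum.inl d), h => by simpa [clash, subst] using h
  | leaf (Sum.inl _), node _ _, _ => by simp [subst]
  | node _ _, leaf (Sum.inl _), _ => by simp [subst]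
  | node a b, node c d, h => by
    simp only [clash, Bool.or_eq_true] at h
    simp only [subst, ne_eq, node.injEq, not_and]
    rcases h with h | h
    · exact fun e => absurd e (subst_ne_of_clash σ τ h)
    · exact fun _ => subst_ne_of_clash σ τ h
  | leaf (Sum.inr _), leaf _, h => by simp [clash] at h
  | leaf (Sum.inr _), node _ _, h => by simp [clash] at h
  | leaf (Sum.inl _), leaf (Sum.inr _), h => by simp [clash] at h
  | node _ _, leaf (Sum.inr _), h => by simp [clash] at h

end Tr

/-- The tree `a` is rewritten to `b` by one of the rules in `R`, applied at the root. -/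
def Rewrites (R : List (Pat × Pat)) (a b : Tr ℕ) : Prop :=
  ∃ ρ ∈ R, ∃ σ, ρ.1.subst σ = a ∧ ρ.2.subst σ = b

/-- The conditions on a rewriting system for the translation into tgds: left sides are linear, right
sides are nodes that do not occur in the left side, and have no other variables; and two different
rules never apply to the same tree. -/
def WellFormed (R : List (Pat × Pat)) : Prop :=
  (∀ ρ ∈ R, ρ.1.subs.Nodup ∧ ρ.1 ∈ ρ.1.subs ∧ ρ.2 ∉ ρ.1.subs ∧
    (∀ q ∈ ρ.2.subs, q ∈ ρ.1.subs ∨ ∃ a b, q = Tr.node a b) ∧ ∃ a b, ρ.2 = Tr.node a b) ∧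
  ∀ ρ ∈ R, ∀ ρ' ∈ R, ρ = ρ' ∨ Tr.clash ρ.1 ρ'.1

theorem WellFormed.eq_of_subst {R : List (Pat × Pat)} (hR : WellFormed R) {ρ ρ' : Pat × Pat}
    (h : ρ ∈ R) (h' : ρ' ∈ R) {σ σ' : ℕ → Tr ℕ} (he : ρ.1.subst σ = ρ'.1.subst σ') : ρ = ρ' :=
  (hR.2 ρ h ρ' h').resolve_right fun hc => Tr.subst_ne_of_clash σ σ' hc he

theorem Tr.subst_congr {σ τ : ℕ → Tr ℕ} : ∀ {p : Pat},
    (∀ v, Tr.leaf (Sum.inr v) ∈ p.subs → σ v = τ v) → p.subst σ = p.subst τ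
  | leaf (Sum.inl _), _ => rfl
  | leaf (Sum.inr v), h => h v (by simp [subs])
  | node a b, h => by
    simp only [subst]
    rw [subst_congr fun v hv => h v (by simp [subs, hv]),
      subst_congr fun v hv => h v (by simp [subs, hv])]

theorem Tr.eq_of_subst_eq {σ τ : ℕ → Tr ℕ} : ∀ {p : Pat}, p.subst σ = p.subst τ →
    ∀ v, Tr.leaf (Sum.inr v) ∈ p.subs → σ v = τ v
  | leaf (Sum.inl _), _, v, h => by simp [subs] at h
  | leaf (Sum.inr w), h, v, hv => by
    simp only [subs, List.mem_singleton, leaf.injEq, Sum.inr.injEq] at hv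
    subst hv
    exact h
  | node a b, h, v, hv => by
    simp only [subst, node.injEq] at h
    simp only [subs, List.mem_cons, reduceCtorEq, List.mem_append, false_or] at hv
    rcases hv with hv | hv
    · exact eq_of_subst_eq h.1 v hv
    · exact eq_of_subst_eq h.2 v hv

/-- The tree determines the rule by the clash condition, and then the values of the left variables,
which include all right variables. -/
theorem WellFormed.rewrites_unique {R : List (Pat × Pat)} (hR : WellFormed R) {a b c : Tr ℕ}
    (hb : Rewrites R a b) (hc : Rewrites R a c) : b = c := by
  obtain ⟨ρ, hρ, σ, h1, rfl⟩ := hb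
  obtain ⟨ρ', hρ', σ', h1', rfl⟩ := hc
  obtain rfl := hR.eq_of_subst hρ hρ' (h1.trans h1'.symm)
  refine Tr.subst_congr fun v hv => Tr.eq_of_subst_eq (h1.trans h1'.symm) v ?_
  rcases ((hR.1 ρ hρ).2.2.2.1 _ hv) with h | ⟨a, b, h⟩
  · exact h
  · cases h

/-! ### A rewriting system that evaluates partial recursive functions -/

open Turing.ToPartrec StateTransition

/-- A natural number as a tree. -/
def natTree : ℕ → Tr ℕ
  | 0 => .leaf 0
  | n + 1 => .node (.leaf 0) (natTree n)

/-- A list of natural numbers as a tree. -/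
def listTree : List ℕ → Tr ℕ
  | [] => .leaf 0
  | a :: v => .node (natTree a) (listTree v)

/-- A code as a tree. -/
def codeTree : Code → Tr ℕ
  | .zero' => .leaf 0
  | .succ => .leaf 1
  | .tail => .leaf 2
  | .cons f g => .node (.leaf 3) (.node (codeTree f) (codeTree g))
  | .comp f g => .node (.leaf 4) (.node (codeTree f) (codeTree g))
  | .case f g => .node (.leaf 5) (.node (codeTree f) (codeTree g))
  | .fix f => .node (.leaf 6) (codeTree f)

/-- A continuation as a tree. -/
def contTree : Cont → Tr ℕ
  | .halt => .leaf 0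
  | .cons₁ f as k => .node (.leaf 1) (.node (codeTree f) (.node (listTree as) (contTree k)))
  | .cons₂ ns k => .node (.leaf 2) (.node (listTree ns) (contTree k))
  | .comp f k => .node (.leaf 3) (.node (codeTree f) (contTree k))
  | .fix f k => .node (.leaf 4) (.node (codeTree f) (contTree k))

/-- The tree for evaluating a code with a continuation on a list. -/
def evTree (c : Code) (k : Cont) (v : List ℕ) : Tr ℕ :=
  .node (.leaf 0) (.node (codeTree c) (.node (contTree k) (listTree v)))

/-- A configuration as a tree. -/
def cfgTree : Cfg → Tr ℕ
  | .ret k v => .node (.leaf 1) (.node (contTree k) (listTree v))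
  | .halt v => .node (.leaf 2) (listTree v)

namespace Interp

/-- A constant. -/
def c (n : ℕ) : Pat := .leaf (Sum.inl n)

/-- A variable. -/
def x (n : ℕ) : Pat := .leaf (Sum.inr n)

/-- A node. -/
def n (p q : Pat) : Pat := .node p q

/-- Evaluate `f` with continuation `k` on `v`. -/
def ev (f k v : Pat) : Pat := n (c 0) (n f (n k v))

/-- Return `v` to the continuation `k`. -/
def rt (k v : Pat) : Pat := n (c 1) (n k v)

/-- The rules of the interpreter. -/
def rules : List (Pat × Pat) :=
  [(ev (c 0) (x 0) (x 1), rt (x 0) (n (c 0) (x 1))),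
   (ev (c 1) (x 0) (c 0), rt (x 0) (n (n (c 0) (c 0)) (c 0))),
   (ev (c 1) (x 0) (n (x 2) (x 1)), rt (x 0) (n (n (c 0) (x 2)) (c 0))),
   (ev (c 2) (x 0) (c 0), rt (x 0) (c 0)),
   (ev (c 2) (x 0) (n (x 2) (x 1)), rt (x 0) (x 1)),
   (ev (n (c 3) (n (x 2) (x 3))) (x 0) (x 1),
     ev (x 2) (n (c 1) (n (x 3) (n (x 1) (x 0)))) (x 1)),
   (ev (n (c 4) (n (x 2) (x 3))) (x 0) (x 1), ev (x 3) (n (c 3) (n (x 2) (x 0))) (x 1)),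
   (ev (n (c 5) (n (x 2) (x 3))) (x 0) (c 0), ev (x 2) (x 0) (c 0)),
   (ev (n (c 5) (n (x 2) (x 3))) (x 0) (n (c 0) (x 1)), ev (x 2) (x 0) (x 1)),
   (ev (n (c 5) (n (x 2) (x 3))) (x 0) (n (n (c 0) (x 4)) (x 1)),
     ev (x 3) (x 0) (n (x 4) (x 1))),
   (ev (n (c 6) (x 2)) (x 0) (x 1), ev (x 2) (n (c 4) (n (x 2) (x 0))) (x 1)),
   (rt (c 0) (x 1), n (c 2) (x 1)),
   (rt (n (c 1) (n (x 2) (n (x 3) (x 0)))) (x 1), ev (x 2) (n (c 2) (n (x 1) (x 0))) (x 3)),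
   (rt (n (c 2) (n (c 0) (x 0))) (x 1), rt (x 0) (n (c 0) (x 1))),
   (rt (n (c 2) (n (n (x 2) (x 3)) (x 0))) (x 1), rt (x 0) (n (x 2) (x 1))),
   (rt (n (c 3) (n (x 2) (x 0))) (x 1), ev (x 2) (x 0) (x 1)),
   (rt (n (c 4) (n (x 2) (x 0))) (c 0), rt (x 0) (c 0)),
   (rt (n (c 4) (n (x 2) (x 0))) (n (c 0) (x 1)), rt (x 0) (x 1)),
   (rt (n (c 4) (n (x 2) (x 0))) (n (n (c 0) (x 4)) (x 1)),
     ev (x 2) (n (c 4) (n (x 2) (x 0))) (x 1))]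

theorem wellFormed_rules : WellFormed rules := by
  have hnode : ∀ ρ ∈ rules, ∃ a b, ρ.2 = Tr.node a b := by
    simp [rules, rt, ev, n]
  -- Being a node is written as a Boolean test so that the condition can be evaluated.
  have h : ∀ ρ ∈ rules, ρ.1.subs.Nodup ∧ ρ.1 ∈ ρ.1.subs ∧ ρ.2 ∉ ρ.1.subs ∧
      ∀ q ∈ ρ.2.subs, q ∈ ρ.1.subs ∨
        (match q with | .leaf _ => false | .node _ _ => true) = true := by decide +kernel
  refine ⟨fun ρ hρ => ⟨(h ρ hρ).1, (h ρ hρ).2.1, (h ρ hρ).2.2.1, fun q hq => ?_, hnode ρ hρ⟩,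
    by decide +kernel⟩
  refine ((h ρ hρ).2.2.2 q hq).imp_right fun hq => ?_
  rcases q with a | ⟨a, b⟩
  · simp at hq
  · exact ⟨a, b, rfl⟩

open Classical in
/-- The transition function of the interpreter. -/
noncomputable def next (a : Tr ℕ) : Option (Tr ℕ) :=
  if h : ∃ b, Rewrites rules a b then some h.choose else none

theorem mem_next {a b : Tr ℕ} : b ∈ next a ↔ Rewrites rules a b := by
  unfold next
  split_ifs with h
  · rw [Option.mem_some_iff]
    exact ⟨fun e => e ▸ h.choose_spec, fun hb =>
      wellFormed_rules.rewrites_unique h.choose_spec hb⟩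
  · simp only [Option.mem_def, reduceCtorEq, false_iff]
    exact fun hb => h ⟨b, hb⟩

/-- The substitution given by a list. -/
def sub (l : List (Tr ℕ)) (v : ℕ) : Tr ℕ := l.getD v (.leaf 0)

theorem mem_next_of_rule (i : ℕ) (hi : i < rules.length) (l : List (Tr ℕ)) {a b : Tr ℕ}
    (ha : (rules[i]).1.subst (sub l) = a) (hb : (rules[i]).2.subst (sub l) = b) : b ∈ next a :=
  mem_next.2 ⟨rules[i], List.getElem_mem hi, sub l, ha, hb⟩

/-- `stepNormal` descends through the code in one step; the rewriting system spends one rule on each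
level of this recursion, hence the induction on `f`. -/
theorem reaches_stepNormal (f : Code) (k : Cont) (v : List ℕ) :
    Reaches₁ next (evTree f k v) (cfgTree (stepNormal f k v)) := by
  induction f generalizing k v with
  | zero' =>
    -- The number is the position in `rules`; the list gives the values of the pattern variables `x
    -- 0`, `x 1`, and so on.
    exact .single (mem_next_of_rule 0 (by decide) [contTree k, listTree v] rfl rfl)
  | succ =>
    rcases v with _ | ⟨a, v⟩
    · exact .single (mem_next_of_rule 1 (by decide) [contTree k] rfl rfl)
    · exact .single (mem_next_of_rule 2 (by decide) [contTree k, listTree v, natTree a] rfl rfl)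
  | tail =>
    rcases v with _ | ⟨a, v⟩
    · exact .single (mem_next_of_rule 3 (by decide) [contTree k] rfl rfl)
    · exact .single (mem_next_of_rule 4 (by decide) [contTree k, listTree v, natTree a] rfl rfl)
  | cons f g ihf ihg =>
    exact .head (mem_next_of_rule 5 (by decide)
      [contTree k, listTree v, codeTree f, codeTree g] rfl rfl) (ihf (.cons₁ g v k) v)
  | comp f g ihf ihg =>
    exact .head (mem_next_of_rule 6 (by decide)
      [contTree k, listTree v, codeTree f, codeTree g] rfl rfl) (ihg (.comp f k) v)
  | case f g ihf ihg =>
    rcases v with _ | ⟨_ | a, v⟩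
    -- `x 1` does not occur in this rule; the leaf only fills its place.
    · exact .head (mem_next_of_rule 7 (by decide)
        [contTree k, .leaf 0, codeTree f, codeTree g] rfl rfl) (ihf k [])
    · exact .head (mem_next_of_rule 8 (by decide)
        [contTree k, listTree v, codeTree f, codeTree g] rfl rfl) (ihf k v)
    · exact .head (mem_next_of_rule 9 (by decide)
        [contTree k, listTree v, codeTree f, codeTree g, natTree a] rfl rfl) (ihg k (a :: v))
  | fix f ihf =>
    exact .head (mem_next_of_rule 10 (by decide)
      [contTree k, listTree v, codeTree f] rfl rfl) (ihf (.fix f k) v)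

theorem reaches_stepRet (k : Cont) (v : List ℕ) :
    Reaches₁ next (cfgTree (.ret k v)) (cfgTree (stepRet k v)) := by
  induction k generalizing v with
  | halt => exact .single (mem_next_of_rule 11 (by decide) [.leaf 0, listTree v] rfl rfl)
  | cons₁ f as k ih =>
    exact .head (mem_next_of_rule 12 (by decide)
      [contTree k, listTree v, codeTree f, listTree as] rfl rfl)
      (reaches_stepNormal f (.cons₂ v k) as)
  | cons₂ ns k ih =>
    rcases ns with _ | ⟨a, ns⟩
    · exact .head (mem_next_of_rule 13 (by decide) [contTree k, listTree v] rfl rfl) (ih (0 :: v))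
    · exact .head (mem_next_of_rule 14 (by decide)
        [contTree k, listTree v, natTree a, listTree ns] rfl rfl) (ih (a :: v))
  | comp f k ih =>
    exact .head (mem_next_of_rule 15 (by decide)
      [contTree k, listTree v, codeTree f] rfl rfl) (reaches_stepNormal f k v)
  | fix f k ih =>
    rcases v with _ | ⟨_ | a, v⟩
    · exact .head (mem_next_of_rule 16 (by decide)
        [contTree k, .leaf 0, codeTree f] rfl rfl) (ih [])
    · exact .head (mem_next_of_rule 17 (by decide)
        [contTree k, listTree v, codeTree f] rfl rfl) (ih v)
    · exact .head (mem_next_of_rule 18 (by decide)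
        [contTree k, listTree v, codeTree f, .leaf 0, natTree a] rfl rfl)
        (reaches_stepNormal f (.fix f k) v)

theorem next_halt (v : List ℕ) : next (cfgTree (.halt v)) = none := by
  rw [Option.eq_none_iff_forall_not_mem]
  intro b hb
  obtain ⟨ρ, hρ, σ, h, -⟩ := mem_next.1 hb
  -- Left sides carry the tag 0 or 1, halting configurations the tag 2.
  have : ∀ ρ ∈ rules, Tr.clash ρ.1 (n (c 2) (x 0)) := by decide
  exact Tr.subst_ne_of_clash σ (fun _ => listTree v) (this ρ hρ) h

theorem respects : Respects step next fun a b => cfgTree a = b := by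
  rintro (v | ⟨k, v⟩) _ rfl
  · exact next_halt _
  · exact ⟨_, rfl, reaches_stepRet _ _⟩

end Interp

/-- The interpreter halts if and only if the code is defined on the input. -/
theorem eval_dom_iff (f : Code) (v : List ℕ) : (f.eval v).Dom ↔
    ∃ b, Relation.ReflTransGen (Rewrites Interp.rules) (evTree f .halt v) b ∧
      ∀ c, ¬ Rewrites Interp.rules b c := by
  have h1 : (f.eval v).Dom ↔ (eval Interp.next (evTree f .halt v)).Dom := by
    rw [reaches_eval (Interp.reaches_stepNormal f .halt v).to_reflTransGen,
      tr_eval_dom Interp.respects rfl, stepNormal_eval]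
    rfl
  rw [h1, Part.dom_iff_mem]
  refine exists_congr fun b => ?_
  rw [mem_eval, Option.eq_none_iff_forall_not_mem]
  refine and_congr ?_ (forall_congr' fun c => not_congr Interp.mem_next)
  have : (fun a b => b ∈ Interp.next a) = Rewrites Interp.rules := by
    funext a b
    exact propext Interp.mem_next
  rw [Reaches, this]

end CoreChase

/-! ### Simulation of rewriting runs by tgds. -/

namespace CoreChase

/-! ### Patterns as conjunctions of atoms -/

/-- The atom which says that `x` is a node with children `y` and `z`. -/
def cell {T : Type} (r : ℕ) (x y z : T) : Atom T := (r, x, [y, z])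

/-- The atom which says that `y` is the root of the configuration that follows the one at `x`. -/
def edge {T : Type} (r : ℕ) (x y : T) : Atom T := (r, x, [y])

theorem cell_inj {T : Type} {r : ℕ} {x y z x' y' z' : T} :
    cell r x y z = cell r x' y' z' ↔ x = x' ∧ y = y' ∧ z = z' := by simp [cell]

theorem edge_inj {T : Type} {r : ℕ} {x y x' y' : T} :
    edge r x y = edge r x' y' ↔ x = x' ∧ y = y' := by simp [edge]

theorem cell_ne_edge {T : Type} {r : ℕ} {x y z x' y' : T} : cell r x y z ≠ edge r x' y' := by
  simp [cell, edge]

theorem map_cell {T U : Type} (f : T → U) (r : ℕ) (x y z : T) :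
    Atom.map f (cell r x y z) = cell r (f x) (f y) (f z) := rfl

theorem map_edge {T U : Type} (f : T → U) (r : ℕ) (x y : T) :
    Atom.map f (edge r x y) = edge r (f x) (f y) := rfl

/-- The term that stands for the root of a tree with children `s` and `t`. -/
def nodeTerm (s t : Term) : Term := Sum.inr (2 * Encodable.encode (s, t) + 1)

namespace Tr

/-- The term that stands for the root of a pattern. -/
def term : Pat → Term
  | leaf (Sum.inl c) => Sum.inl c
  | leaf (Sum.inr v) => Sum.inr (2 * v + 2)
  | node a b => nodeTerm (term a) (term b)

/-- The atoms which say that the root of a pattern is the root of such a tree. -/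
def atoms (r : ℕ) : Pat → List (Atom Term)
  | leaf _ => []
  | node a b => cell r (term (node a b)) (term a) (term b) :: (atoms r a ++ atoms r b)

theorem nodeTerm_inj {s t s' t' : Term} (h : nodeTerm s t = nodeTerm s' t') :
    s = s' ∧ t = t' := by
  simp only [nodeTerm, Sum.inr.injEq] at h
  have h2 : (s, t) = (s', t') := Encodable.encode_injective (by omega)
  simpa using h2

/-- Odd variables name nodes by the terms of their children, even ones from 2 on name pattern
variables. So equal subpatterns share a term, also across the two sides of a rule, and different
ones never do. -/
theorem term_injective : ∀ {p q : Pat}, term p = term q → p = q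
  | leaf (Sum.inl c), leaf (Sum.inl d), h => by simpa [term] using h
  | leaf (Sum.inl _), leaf (Sum.inr _), h => by simp [term] at h
  | leaf (Sum.inr _), leaf (Sum.inl _), h => by simp [term] at h
  | leaf (Sum.inr v), leaf (Sum.inr w), h => by
    simp only [term, Sum.inr.injEq] at h
    have : v = w := by omega
    rw [this]
  | leaf (Sum.inl _), node _ _, h => by simp [term, nodeTerm] at h
  | leaf (Sum.inr _), node _ _, h => by
    simp only [term, nodeTerm, Sum.inr.injEq] at h
    omega
  | node _ _, leaf (Sum.inl _), h => by simp [term, nodeTerm] at h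
  | node _ _, leaf (Sum.inr _), h => by
    simp only [term, nodeTerm, Sum.inr.injEq] at h
    omega
  | node a b, node c d, h => by
    obtain ⟨h1, h2⟩ := nodeTerm_inj (by simpa only [term] using h)
    rw [term_injective h1, term_injective h2]

/-- The variable 0 is reserved for the predecessor configuration in the body of `ruleTGD`. -/
theorem term_ne_zero : ∀ p : Pat, term p ≠ Sum.inr 0
  | leaf (Sum.inl _) => by simp [term]
  | leaf (Sum.inr _) => by simp [term]
  | node _ _ => by simp [term, nodeTerm]

theorem exists_term_eq_inl_or_mem_subs : ∀ p : Pat, (∃ c, term p = Sum.inl c) ∨ p ∈ subs p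
  | leaf (Sum.inl c) => Or.inl ⟨c, rfl⟩
  | leaf (Sum.inr _) => Or.inr (by simp [subs])
  | node _ _ => Or.inr (by simp [subs])

theorem subs_trans : ∀ {p q s : Pat}, q ∈ subs p → s ∈ subs q → s ∈ subs p
  | leaf (Sum.inl _), _, _, h, _ => by simp [subs] at h
  | leaf (Sum.inr _), _, _, h, h' => by
    simp only [subs, List.mem_singleton] at h
    exact h ▸ h'
  | node a b, q, s, h, h' => by
    simp only [subs, List.mem_cons, List.mem_append] at h
    rcases h with rfl | h | h
    · exact h'
    · exact List.mem_cons_of_mem _ (List.mem_append_left _ (subs_trans h h'))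
    · exact List.mem_cons_of_mem _ (List.mem_append_right _ (subs_trans h h'))

theorem mem_atoms {r : ℕ} : ∀ {p : Pat} {α : Atom Term}, α ∈ atoms r p ↔
    ∃ a b, node a b ∈ subs p ∧ α = cell r (term (node a b)) (term a) (term b)
  | leaf (Sum.inl _), _ => by simp [atoms, subs]
  | leaf (Sum.inr _), _ => by simp [atoms, subs]
  | node a b, α => by
    simp only [atoms, List.mem_cons, List.mem_append, subs, node.injEq, mem_atoms (p := a),
      mem_atoms (p := b)]
    constructor
    · rintro (h | ⟨c, d, h, e⟩ | ⟨c, d, h, e⟩)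
      · exact ⟨a, b, Or.inl ⟨rfl, rfl⟩, h⟩
      · exact ⟨c, d, Or.inr (Or.inl h), e⟩
      · exact ⟨c, d, Or.inr (Or.inr h), e⟩
    · rintro ⟨c, d, ⟨rfl, rfl⟩ | h | h, e⟩
      · exact Or.inl e
      · exact Or.inr (Or.inl ⟨c, d, h, e⟩)
      · exact Or.inr (Or.inr ⟨c, d, h, e⟩)

theorem mem_subs_of_term_eq_inr {p : Pat} {v : ℕ} (h : term p = Sum.inr v) : p ∈ subs p := by
  rcases exists_term_eq_inl_or_mem_subs p with ⟨c, hc⟩ | h'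
  · rw [hc] at h
    cases h
  · exact h'

theorem exists_of_mem_varsOf_atoms {r : ℕ} {p : Pat} {v : ℕ} (h : v ∈ varsOf (atoms r p)) :
    ∃ q ∈ subs p, term q = Sum.inr v := by
  obtain ⟨α, hα, hv⟩ := mem_varsOf.1 h
  obtain ⟨a, b, hab, rfl⟩ := mem_atoms.1 hα
  simp only [Atom.args, cell, List.mem_cons, List.not_mem_nil, or_false] at hv
  rcases hv with hv | hv | hv
  · exact ⟨_, hab, hv.symm⟩
  · exact ⟨a, subs_trans hab (List.mem_cons_of_mem _ (List.mem_append_left _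
      (mem_subs_of_term_eq_inr hv.symm))), hv.symm⟩
  · exact ⟨b, subs_trans hab (List.mem_cons_of_mem _ (List.mem_append_right _
      (mem_subs_of_term_eq_inr hv.symm))), hv.symm⟩

theorem eq_or_mem_varsOf_atoms {r : ℕ} : ∀ {p q : Pat} {v : ℕ}, q ∈ subs p →
    term q = Sum.inr v → q = p ∨ v ∈ varsOf (atoms r p)
  | leaf (Sum.inl _), _, _, h, _ => by simp [subs] at h
  | leaf (Sum.inr _), _, _, h, _ => by
    simp only [subs, List.mem_singleton] at h
    exact Or.inl h
  | node a b, q, v, h, hv => by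
    simp only [subs, List.mem_cons, List.mem_append] at h
    have key : ∀ c, (∀ α ∈ atoms r c, α ∈ atoms r (node a b)) →
        (term c ∈ Atom.args (cell r (term (node a b)) (term a) (term b))) →
        (q = c ∨ v ∈ varsOf (atoms r c)) → v ∈ varsOf (atoms r (node a b)) := by
      rintro c h1 h2 (rfl | h3)
      · exact mem_varsOf.2 ⟨_, by simp [atoms], hv ▸ h2⟩
      · obtain ⟨α, hα, h⟩ := mem_varsOf.1 h3
        exact mem_varsOf.2 ⟨α, h1 α hα, h⟩
    rcases h with h | h | h
    · exact Or.inl h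
    · exact Or.inr (key a (fun α hα => by simp [atoms, hα]) (by simp [Atom.args, cell])
        (eq_or_mem_varsOf_atoms h hv))
    · exact Or.inr (key b (fun α hα => by simp [atoms, hα]) (by simp [Atom.args, cell])
        (eq_or_mem_varsOf_atoms h hv))

theorem subst_ground (σ : ℕ → Tr ℕ) : ∀ t : Tr ℕ, subst σ (ground t) = t
  | leaf _ => rfl
  | node a b => by simp [ground, subst, subst_ground σ a, subst_ground σ b]

theorem leaf_notMem_subs_ground (v : ℕ) : ∀ t : Tr ℕ, leaf (Sum.inr v) ∉ subs (ground t)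
  | leaf _ => by simp [ground, subs]
  | node a b => by
    simp [ground, subs, leaf_notMem_subs_ground v a, leaf_notMem_subs_ground v b]

end Tr

open Tr

/-! ### Trees in instances -/

/-- `x` is the root of the tree `t` in `J`. -/
def Rep (r : ℕ) (J : Instance) : Tr ℕ → Value → Prop
  | leaf c, x => x = Sum.inl c
  | node a b, x => ∃ y z, cell r x y z ∈ J ∧ Rep r J a y ∧ Rep r J b z

theorem Rep.mono {r : ℕ} {J J' : Instance} (h : J ⊆ J') : ∀ {t : Tr ℕ} {x : Value},
    Rep r J t x → Rep r J' t x
  | leaf _, _, hx => hx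
  | node _ _, _, ⟨y, z, hc, ha, hb⟩ => ⟨y, z, h hc, Rep.mono h ha, Rep.mono h hb⟩

/-- The children of a node are unique, and constants are not nodes. -/
structure Functional (r : ℕ) (J : Instance) : Prop where
  unique : ∀ x y z y' z', cell r x y z ∈ J → cell r x y' z' ∈ J → y = y' ∧ z = z'
  null : ∀ c y z, cell r (Sum.inl c) y z ∉ J

theorem Rep.unique {r : ℕ} {J : Instance} (hJ : Functional r J) : ∀ {s t : Tr ℕ} {x : Value},
    Rep r J s x → Rep r J t x → s = t
  | leaf c, leaf d, x, h, h' => by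
    have : (Sum.inl c : Value) = Sum.inl d := Eq.trans (Eq.symm h) h'
    simpa using this
  | leaf c, node a b, x, h, ⟨y, z, hc, _⟩ => by
    obtain rfl : x = Sum.inl c := h
    exact absurd hc (hJ.null _ _ _)
  | node a b, leaf c, x, ⟨y, z, hc, _⟩, h => by
    obtain rfl : x = Sum.inl c := h
    exact absurd hc (hJ.null _ _ _)
  | node a b, node a' b', x, ⟨y, z, hc, ha, hb⟩, ⟨y', z', hc', ha', hb'⟩ => by
    obtain ⟨rfl, rfl⟩ := hJ.unique _ _ _ _ _ hc hc'
    rw [Rep.unique hJ ha ha', Rep.unique hJ hb hb']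

open Classical in
/-- A linear pattern that matches a tree can be mapped to any copy of the tree. -/
theorem exists_match {r : ℕ} {J : Instance} {σ : ℕ → Tr ℕ} : ∀ {p : Pat} {x : Value},
    p.subs.Nodup → Rep r J (p.subst σ) x → ∃ h : ℕ → Value,
      termVal h p.term = x ∧ MapsInto h (p.atoms r) J ∧
      ∀ v, leaf (Sum.inr v) ∈ p.subs → Rep r J (σ v) (h (2 * v + 2))
  | leaf (Sum.inl c), x, _, hx => ⟨fun _ => Sum.inl 0, Eq.symm hx, by simp [MapsInto, atoms],
      by simp [subs]⟩
  | leaf (Sum.inr v), x, _, hx => ⟨fun _ => x, rfl, by simp [MapsInto, atoms], by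
      intro w hw
      simp only [subs, List.mem_singleton, leaf.injEq, Sum.inr.injEq] at hw
      subst hw
      exact hx⟩
  | node a b, x, hn, ⟨y, z, hc, ha, hb⟩ => by
    simp only [subs, List.nodup_cons, List.mem_append, not_or, List.nodup_append] at hn
    obtain ⟨⟨hna, hnb⟩, hda, hdb, hab⟩ := hn
    obtain ⟨f, hfy, hfa, hfr⟩ := exists_match hda ha
    obtain ⟨g, hgz, hgb, hgr⟩ := exists_match hdb hb
    -- Linearity makes the variables of the root and of the two subpatterns disjoint, so the partial
    -- matches can be glued. Equal subtrees may have different roots in `J`, so a repeated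
    -- subpattern could not be matched this way.
    let h : ℕ → Value := fun v => if term (node a b) = Sum.inr v then x else
      if ∃ q ∈ subs a, term q = Sum.inr v then f v else g v
    have h1 : ∀ q ∈ subs a, ∀ v, term q = Sum.inr v → h v = f v := by
      intro q hq v hv
      have hne : term (node a b) ≠ Sum.inr v := fun e =>
        hna (term_injective (e.trans hv.symm) ▸ hq)
      simp only [h, if_neg hne]
      exact if_pos ⟨q, hq, hv⟩
    have h2 : ∀ q ∈ subs b, ∀ v, term q = Sum.inr v → h v = g v := by
      intro q hq v hv
      have hne : term (node a b) ≠ Sum.inr v := fun e =>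
        hnb (term_injective (e.trans hv.symm) ▸ hq)
      simp only [h, if_neg hne]
      refine if_neg ?_
      rintro ⟨q', hq', hv'⟩
      exact hab _ hq' _ hq (term_injective (hv'.trans hv.symm))
    have hx : termVal h (term (node a b)) = x := by
      exact if_pos rfl
    have root : ∀ (c : Pat) (e : ℕ → Value), (∀ v, term c = Sum.inr v → h v = e v) →
        termVal h (term c) = termVal e (term c) := by
      intro c e he
      rcases hc' : term c with d | v
      · rfl
      · exact he v hc'
    have hy : termVal h (term a) = y := by
      rw [root a f fun v hv => h1 a (mem_subs_of_term_eq_inr hv) v hv, hfy]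
    have hz : termVal h (term b) = z := by
      rw [root b g fun v hv => h2 b (mem_subs_of_term_eq_inr hv) v hv, hgz]
    refine ⟨h, hx, fun α hα => ?_, fun v hv => ?_⟩
    · simp only [atoms, List.mem_cons, List.mem_append] at hα
      rcases hα with rfl | hα | hα
      · rw [map_cell, hx, hy, hz]
        exact hc
      · rw [map_termVal_congr (g := f) (fun v hv => ?_) hα]
        · exact hfa α hα
        · obtain ⟨q, hq, hv⟩ := exists_of_mem_varsOf_atoms hv
          exact h1 q hq v hv
      · rw [map_termVal_congr (g := g) (fun v hv => ?_) hα]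
        · exact hgb α hα
        · obtain ⟨q, hq, hv⟩ := exists_of_mem_varsOf_atoms hv
          exact h2 q hq v hv
    · simp only [subs, List.mem_cons, reduceCtorEq, List.mem_append, false_or] at hv
      rcases hv with hv | hv
      · rw [h1 _ hv _ rfl]
        exact hfr v hv
      · rw [h2 _ hv _ rfl]
        exact hgr v hv

theorem MapsInto.cell_mem {r : ℕ} {J : Instance} {h : ℕ → Value} {a b : Pat}
    (hm : MapsInto h ((node a b).atoms r) J) :
    cell r (termVal h (node a b).term) (termVal h a.term) (termVal h b.term) ∈ J :=
  hm _ List.mem_cons_self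

theorem MapsInto.left {r : ℕ} {J : Instance} {h : ℕ → Value} {a b : Pat}
    (hm : MapsInto h ((node a b).atoms r) J) : MapsInto h (a.atoms r) J :=
  fun _ hα => hm _ (List.mem_cons_of_mem _ (List.mem_append_left _ hα))

theorem MapsInto.right {r : ℕ} {J : Instance} {h : ℕ → Value} {a b : Pat}
    (hm : MapsInto h ((node a b).atoms r) J) : MapsInto h (b.atoms r) J :=
  fun _ hα => hm _ (List.mem_cons_of_mem _ (List.mem_append_right _ hα))

open Classical in
/-- The tree with root `x` in `J`, if there is one. -/
noncomputable def treeAt (r : ℕ) (J : Instance) (x : Value) : Tr ℕ :=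
  if h : ∃ t, Rep r J t x then h.choose else leaf 0

theorem Rep.treeAt_eq {r : ℕ} {J : Instance} (hJ : Functional r J) {t : Tr ℕ} {x : Value}
    (h : Rep r J t x) : treeAt r J x = t := by
  have hex : ∃ t, Rep r J t x := ⟨t, h⟩
  rw [treeAt, dif_pos hex]
  exact Rep.unique hJ hex.choose_spec h

/-- If the atoms of a pattern are mapped to the root of a tree, then the pattern matches it. -/
theorem subst_treeAt {r : ℕ} {J : Instance} (hJ : Functional r J) {h : ℕ → Value} :
    ∀ {p : Pat} {t : Tr ℕ}, MapsInto h (p.atoms r) J → Rep r J t (termVal h p.term) →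
      p.subst (fun v => treeAt r J (h (2 * v + 2))) = t
  | leaf (Sum.inl c), leaf d, _, ht => by
    have : (Sum.inl c : Value) = Sum.inl d := ht
    simpa [subst] using this
  | leaf (Sum.inl c), node a b, _, ⟨_, _, hc, _⟩ => absurd hc (hJ.null _ _ _)
  | leaf (Sum.inr v), t, _, ht => Rep.treeAt_eq hJ ht
  | node a b, leaf d, hm, ht => by
    have h1 := hm.cell_mem
    rw [show termVal h (node a b).term = Sum.inl d from ht] at h1
    exact absurd h1 (hJ.null _ _ _)
  | node a b, node c d, hm, ⟨y, z, hc, hy, hz⟩ => by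
    obtain ⟨rfl, rfl⟩ := hJ.unique _ _ _ _ _ hc hm.cell_mem
    simp only [subst]
    rw [subst_treeAt hJ hm.left hy, subst_treeAt hJ hm.right hz]

/-- Descend from the root: in a functional instance the children are determined at each node. -/
theorem match_unique {r : ℕ} {J : Instance} (hJ : Functional r J) {h h' : ℕ → Value} :
    ∀ {p : Pat}, MapsInto h (p.atoms r) J → MapsInto h' (p.atoms r) J →
      termVal h p.term = termVal h' p.term →
      ∀ q ∈ p.subs, termVal h q.term = termVal h' q.term
  | leaf (Sum.inl _), _, _, _, q, hq => by simp [subs] at hq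
  | leaf (Sum.inr _), _, _, he, q, hq => by
    simp only [subs, List.mem_singleton] at hq
    exact hq ▸ he
  | node a b, hm, hm', he, q, hq => by
    have h1 := hm'.cell_mem
    rw [← he] at h1
    obtain ⟨h2, h3⟩ := hJ.unique _ _ _ _ _ hm.cell_mem h1
    simp only [subs, List.mem_cons, List.mem_append] at hq
    rcases hq with rfl | hq | hq
    · exact he
    · exact match_unique hJ hm.left hm'.left h2 q hq
    · exact match_unique hJ hm.right hm'.right h3 q hq

/-! ### The tgds of a rewriting system -/

/-- The tgd of a rewriting rule. -/
def ruleTGD (r : ℕ) (ρ : Pat × Pat) : TGD :=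
  (edge r (Sum.inr 0) ρ.1.term :: ρ.1.atoms r, edge r ρ.1.term ρ.2.term :: ρ.2.atoms r)

/-- The tgd that creates a tree. -/
def initTGD (r : ℕ) (p : Pat) : TGD := ([], edge r (Sum.inl 0) p.term :: p.atoms r)

/-- The tgd `ξ` attaches a new copy of the pattern `p` by an edge to the element `t`; its nodes that
are not new belong to the body. -/
structure Attaches (r : ℕ) (ξ : TGD) (t : Term) (p : Pat) : Prop where
  head : TGD.head ξ = edge r t p.term :: p.atoms r
  anchor : ∀ v, t = Sum.inr v → v ∈ varsOf (TGD.body ξ)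
  root : ∃ n, p.term = Sum.inr n ∧ n ∉ varsOf (TGD.body ξ)
  shared : ∀ a b, node a b ∈ p.subs → ∀ v ∈ varsOf (TGD.body ξ), term (node a b) = Sum.inr v →
    cell r (term (node a b)) a.term b.term ∈ TGD.body ξ
  leaves : ∀ v, leaf (Sum.inr v) ∈ p.subs → 2 * v + 2 ∈ varsOf (TGD.body ξ)

theorem attaches_init (r : ℕ) (a b : Tr ℕ) :
    Attaches r (initTGD r (ground (node a b))) (Sum.inl 0) (ground (node a b)) where
  head := rfl
  anchor := by simp
  root := ⟨_, rfl, by simp [initTGD, TGD.body, varsOf]⟩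
  shared := by simp [initTGD, TGD.body, varsOf]
  leaves := fun v hv => absurd hv (leaf_notMem_subs_ground v _)

theorem mem_varsOf_body_ruleTGD {r : ℕ} {ρ : Pat × Pat} (h : ρ.1 ∈ ρ.1.subs) {v : ℕ} :
    v ∈ varsOf (TGD.body (ruleTGD r ρ)) ↔ v = 0 ∨ ∃ q ∈ ρ.1.subs, q.term = Sum.inr v := by
  constructor
  · intro hv
    obtain ⟨α, hα, hv⟩ := mem_varsOf.1 hv
    rcases List.mem_cons.1 hα with rfl | hα
    · simp only [Atom.args, edge, List.mem_cons, Sum.inr.injEq, List.not_mem_nil, or_false] at hv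
      exact hv.imp_right fun hv => ⟨ρ.1, h, hv.symm⟩
    · exact Or.inr (exists_of_mem_varsOf_atoms (mem_varsOf.2 ⟨α, hα, hv⟩))
  · rintro (rfl | ⟨q, hq, hv⟩)
    · exact mem_varsOf.2 ⟨_, List.mem_cons_self, by simp [Atom.args, edge]⟩
    · rcases eq_or_mem_varsOf_atoms (r := r) hq hv with rfl | hv'
      · exact mem_varsOf.2 ⟨_, List.mem_cons_self, by simp [Atom.args, edge, hv]⟩
      · obtain ⟨α, hα, hv⟩ := mem_varsOf.1 hv'
        exact mem_varsOf.2 ⟨α, List.mem_cons_of_mem _ hα, hv⟩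

/-- A right-hand node whose term occurs in the body is, by `term_injective`, a left-hand subpattern,
so its cell is already there. The root of the right side is not such a subpattern and therefore gets
a fresh null. -/
theorem attaches_rule {R : List (Pat × Pat)} (hR : WellFormed R) {ρ : Pat × Pat} (hρ : ρ ∈ R)
    (r : ℕ) : Attaches r (ruleTGD r ρ) ρ.1.term ρ.2 := by
  obtain ⟨-, h1, h2, h3, a, b, hab⟩ := hR.1 ρ hρ
  have hv := fun v => mem_varsOf_body_ruleTGD (r := r) h1 (v := v)
  have hsub : ∀ q v, q.term = Sum.inr v → v ∈ varsOf (TGD.body (ruleTGD r ρ)) → q ∈ ρ.1.subs := by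
    intro q v hq hvb
    rcases (hv v).1 hvb with rfl | ⟨q', hq', e⟩
    · exact absurd hq (term_ne_zero q)
    · exact term_injective (e.trans hq.symm) ▸ hq'
  refine ⟨rfl, fun v e => (hv v).2 (Or.inr ⟨_, h1, e⟩), ?_, fun a b _ v hvb e => ?_, fun v hl => ?_⟩
  · obtain ⟨n, hn⟩ : ∃ n, ρ.2.term = Sum.inr n := ⟨_, by rw [hab]; rfl⟩
    exact ⟨n, hn, fun hb => h2 (hsub _ _ hn hb)⟩
  · exact List.mem_cons_of_mem _ (mem_atoms.2 ⟨a, b, hsub _ _ e hvb, rfl⟩)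
  · rcases h3 _ hl with h | ⟨a, b, h⟩
    · exact (hv _).2 (Or.inr ⟨_, h, rfl⟩)
    · cases h

section Attach

variable {r : ℕ} {ξ : TGD} {t : Term} {p : Pat} {J : Instance} {f : ℕ → Value} {N : ℕ}

theorem Attaches.freshExt_anchor (h : Attaches r ξ t p) :
    termVal (freshExt ξ f N) t = termVal f t := by
  rcases t with c | v
  · rfl
  · exact freshExt_of_mem (h.anchor v rfl)

theorem Attaches.edge_mem_iff (h : Attaches r ξ t p) {x y : Value} :
    edge r x y ∈ J ∪ fired ξ f N ↔
      edge r x y ∈ J ∨ x = termVal f t ∧ y = termVal (freshExt ξ f N) p.term := by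
  rw [Finset.mem_union, mem_fired, h.head]
  refine or_congr_right ⟨?_, ?_⟩
  · rintro ⟨α, hα, e⟩
    rcases List.mem_cons.1 hα with rfl | hα
    · rw [map_edge, edge_inj, h.freshExt_anchor] at e
      exact ⟨e.1.symm, e.2.symm⟩
    · obtain ⟨a, b, -, rfl⟩ := mem_atoms.1 hα
      exact absurd e cell_ne_edge
  · rintro ⟨rfl, rfl⟩
    exact ⟨_, List.mem_cons_self, by rw [map_edge, h.freshExt_anchor]⟩

theorem Attaches.cell_mem (h : Attaches r ξ t p) (hf : MapsInto f (TGD.body ξ) J) {x y z : Value}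
    (hx : cell r x y z ∈ J ∪ fired ξ f N) : cell r x y z ∈ J ∨ ∃ a b n,
      term (node a b) = Sum.inr n ∧ x = Sum.inr (N + n) ∧
        y = termVal (freshExt ξ f N) a.term ∧ z = termVal (freshExt ξ f N) b.term := by
  rcases Finset.mem_union.1 hx with hx | hx
  · exact Or.inl hx
  rw [mem_fired, h.head] at hx
  obtain ⟨α, hα, e⟩ := hx
  rcases List.mem_cons.1 hα with rfl | hα
  · exact absurd e.symm cell_ne_edge
  obtain ⟨a, b, hab, rfl⟩ := mem_atoms.1 hα
  obtain ⟨n, hn⟩ : ∃ n, term (node a b) = Sum.inr n := ⟨_, rfl⟩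
  by_cases hv : n ∈ varsOf (TGD.body ξ)
  · left
    rw [← e, map_termVal_congr (fun v hv => freshExt_of_mem hv) (h.shared a b hab n hv hn)]
    exact hf _ (h.shared a b hab n hv hn)
  · right
    rw [map_cell, cell_inj] at e
    refine ⟨a, b, n, hn, ?_, e.2.1.symm, e.2.2.symm⟩
    rw [← e.1, hn]
    exact if_neg hv

/-- Each cell that is not in `J` has a fresh null in first place, and this null determines the node
pattern, hence the children. -/
theorem Attaches.functional (h : Attaches r ξ t p) (hf : MapsInto f (TGD.body ξ) J)
    (hN : NullsBelow N J) (hJ : Functional r J) : Functional r (J ∪ fired ξ f N) := by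
  have fresh : ∀ n y z, cell r (Sum.inr (N + n)) y z ∉ J := fun n y z hc =>
    absurd (hN _ hc (N + n) List.mem_cons_self) (by omega)
  constructor
  · intro x y z y' z' h1 h2
    rcases h.cell_mem hf h1 with h1 | ⟨a, b, n, hn, rfl, rfl, rfl⟩
    · rcases h.cell_mem hf h2 with h2 | ⟨a, b, n, hn, rfl, rfl, rfl⟩
      · exact hJ.unique _ _ _ _ _ h1 h2
      · exact absurd h1 (fresh _ _ _)
    · rcases h.cell_mem hf h2 with h2 | ⟨a', b', n', hn', hx, rfl, rfl⟩
      · exact absurd h2 (fresh _ _ _)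
      · have : n = n' := by simpa using hx
        subst this
        have := term_injective (hn.trans hn'.symm)
        rw [node.injEq] at this
        rw [this.1, this.2]
        exact ⟨rfl, rfl⟩
  · intro c y z h1
    rcases h.cell_mem hf h1 with h1 | ⟨a, b, n, hn, hx, -⟩
    · exact hJ.null _ _ _ h1
    · cases hx

theorem Attaches.rep (h : Attaches r ξ t p) {σ : ℕ → Tr ℕ}
    (hσ : ∀ v, leaf (Sum.inr v) ∈ p.subs → Rep r J (σ v) (f (2 * v + 2))) :
    Rep r (J ∪ fired ξ f N) (p.subst σ) (termVal (freshExt ξ f N) p.term) := by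
  have key : ∀ q : Pat, (∀ s ∈ q.subs, s ∈ p.subs) →
      Rep r (J ∪ fired ξ f N) (q.subst σ) (termVal (freshExt ξ f N) q.term) := by
    intro q
    induction q with
    | leaf a =>
      intro hs
      rcases a with c | v
      · exact rfl
      · have hv := hs _ (List.mem_singleton.2 rfl)
        have e : termVal (freshExt ξ f N) (term (leaf (Sum.inr v))) = f (2 * v + 2) :=
          freshExt_of_mem (h.leaves v hv)
        rw [e]
        exact (hσ v hv).mono Finset.subset_union_left
    | node a b iha ihb =>
      intro hs
      refine ⟨_, _, Finset.mem_union_right _ (mem_fired.2 ⟨_, ?_, map_cell _ _ _ _ _⟩),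
        iha fun s hs' => hs s (List.mem_cons_of_mem _ (List.mem_append_left _ hs')),
        ihb fun s hs' => hs s (List.mem_cons_of_mem _ (List.mem_append_right _ hs'))⟩
      rw [h.head]
      exact List.mem_cons_of_mem _ (mem_atoms.2 ⟨a, b, hs _ List.mem_cons_self, rfl⟩)
  exact key p fun _ hs => hs

end Attach

/-! ### Edges lead to newer nulls -/

/-- The age of a value. -/
def rank : Value → ℕ := Sum.elim (fun _ => 0) Nat.succ

/-- Edges increase the rank. -/
def Increasing (r : ℕ) (J : Instance) : Prop := ∀ x y, edge r x y ∈ J → rank x < rank y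

/-- The new edge starts at a constant or at a null below `N` and ends at a fresh null `N + n`. -/
theorem Attaches.increasing {r : ℕ} {ξ : TGD} {t : Term} {p : Pat} {J : Instance} {f : ℕ → Value}
    {N : ℕ} (h : Attaches r ξ t p) (hf : MapsInto f (TGD.body ξ) J) (hN : NullsBelow N J)
    (hJ : Increasing r J) : Increasing r (J ∪ fired ξ f N) := by
  intro x y hxy
  rcases h.edge_mem_iff.1 hxy with hxy | ⟨rfl, rfl⟩
  · exact hJ x y hxy
  obtain ⟨n, hn, hnb⟩ := h.root
  have h1 : rank (termVal f t) ≤ N := by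
    rcases t with c | v
    · exact Nat.zero_le _
    · obtain ⟨α, hα, hv⟩ := mem_varsOf.1 (h.anchor v rfl)
      change rank (f v) ≤ N
      rcases hfv : f v with c | m
      · exact Nat.zero_le _
      · refine hN _ (hf α hα) m ?_
        rw [Atom.args_map]
        exact List.mem_map.2 ⟨_, hv, hfv⟩
  have h2 : termVal (freshExt ξ f N) p.term = Sum.inr (N + n) := by
    rw [hn]
    exact if_neg hnb
  rw [h2]
  change _ < N + n + 1
  omega

/-- `y` is the end of a path with `k` edges. -/
def Chain (r : ℕ) (J : Instance) : ℕ → Value → Prop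
  | 0, _ => True
  | k + 1, y => ∃ x, edge r x y ∈ J ∧ Chain r J k x

theorem Chain.map {r : ℕ} {J M : Instance} {φ : ℕ → Value} (hφ : Sends φ J M) :
    ∀ {k : ℕ} {y : Value}, Chain r J k y → Chain r M k (termVal φ y)
  | 0, _, _ => trivial
  | _ + 1, _, ⟨x, hx, hc⟩ => ⟨termVal φ x, hφ _ hx, Chain.map hφ hc⟩

theorem Chain.mono {r : ℕ} {J M : Instance} (h : J ⊆ M) :
    ∀ {k : ℕ} {y : Value}, Chain r J k y → Chain r M k y
  | 0, _, _ => trivial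
  | _ + 1, _, ⟨x, hx, hc⟩ => ⟨x, h hx, Chain.mono h hc⟩

theorem Chain.le_rank {r : ℕ} {J : Instance} (hJ : Increasing r J) :
    ∀ {k : ℕ} {y : Value}, Chain r J k y → k ≤ rank y
  | 0, _, _ => Nat.zero_le _
  | _ + 1, _, ⟨_, hx, hc⟩ => Nat.succ_le_of_lt ((Chain.le_rank hJ hc).trans_lt (hJ _ _ hx))

/-! ### Runs of a rewriting system -/

/-- The tgds for the runs of `R` from `t`. -/
def tgds (r : ℕ) (R : List (Pat × Pat)) (t : Tr ℕ) : List TGD :=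
  initTGD r (ground t) :: R.map (ruleTGD r)

/-- `J` is derived from `I` and contains a run of `R` of length `k` from `t` to the tree `s` with
root `x`, in which every rule has been applied to the earlier configurations. -/
structure IsRun (r : ℕ) (R : List (Pat × Pat)) (t : Tr ℕ) (I J : Instance) (k : ℕ) (s : Tr ℕ)
    (x : Value) : Prop where
  deriv : Deriv (tgds r R t).toFinset I J
  functional : Functional r J
  rep : Rep r J s x
  init : ∃ e, MapsInto e (TGD.head (initTGD r (ground t))) J
  edges : ∀ w y, edge r w y ∈ J → (∃ a, Rep r J a y) ∧ (y = x ∨ ∃ ρ ∈ R, ∃ h,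
    MapsInto h (TGD.body (ruleTGD r ρ)) J ∧ termVal h ρ.1.term = y ∧
      MapsInto h (TGD.head (ruleTGD r ρ)) J)
  chain : Chain r J (k + 1) x

section Run

variable {r : ℕ} {R : List (Pat × Pat)} {I : Instance}

theorem mapsInto_fired (ξ : TGD) (f : ℕ → Value) (N : ℕ) (J : Instance) :
    MapsInto (freshExt ξ f N) (TGD.head ξ) (J ∪ fired ξ f N) := fun α hα =>
  Finset.mem_union_right _ (mem_fired.2 ⟨α, hα, rfl⟩)

theorem exists_isRun_zero (hI : ∀ a ∈ I, a.1 ≠ r) (a b : Tr ℕ) :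
    ∃ J x, IsRun r R (node a b) I J 0 (node a b) x := by
  obtain ⟨N, hN⟩ := exists_nullsBelow I
  have hatt := attaches_init r a b
  set ξ := initTGD r (ground (node a b)) with hξ
  let f : ℕ → Value := fun _ => Sum.inl 0
  have hf : MapsInto f (TGD.body ξ) I := fun α hα => by simp [hξ, initTGD, TGD.body] at hα
  have hI0 : Functional r I :=
    ⟨fun x y z y' z' h => absurd rfl (hI _ h), fun c y z h => absurd rfl (hI _ h)⟩
  have hrep : Rep r (I ∪ fired ξ f N) (node a b)
      (termVal (freshExt ξ f N) (ground (node a b)).term) := by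
    have := hatt.rep (J := I) (f := f) (N := N) (σ := fun _ => leaf 0)
      fun v hv => absurd hv (leaf_notMem_subs_ground v _)
    rwa [subst_ground] at this
  refine ⟨I ∪ fired ξ f N, _, ?_, hatt.functional hf hN hI0, hrep, ⟨_, mapsInto_fired ξ f N I⟩,
    fun w y hwy => ?_, ⟨_, hatt.edge_mem_iff.2 (Or.inr ⟨rfl, rfl⟩), trivial⟩⟩
  · exact Deriv.step ξ f N Deriv.refl (by simp [tgds, hξ]) hf hN
  · rcases hatt.edge_mem_iff.1 hwy with h | ⟨-, rfl⟩
    · exact absurd rfl (hI _ h)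
    · exact ⟨⟨_, hrep⟩, Or.inl rfl⟩

/-- Match the left side at the root `x`, fire the tgd of the rule, and take the fresh root as the
new end of the chain. -/
theorem IsRun.step (hR : WellFormed R) {t s s' : Tr ℕ} {J : Instance} {k : ℕ} {x : Value}
    (h : IsRun r R t I J k s x) (hs : Rewrites R s s') :
    ∃ J' x', IsRun r R t I J' (k + 1) s' x' := by
  obtain ⟨ρ, hρ, σ, rfl, rfl⟩ := hs
  obtain ⟨w, hw, -⟩ := h.chain
  obtain ⟨hlin, hroot, -, hvars, -⟩ := hR.1 ρ hρ
  obtain ⟨g, hg, hgJ, hgσ⟩ := exists_match hlin h.rep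
  obtain ⟨N, hN⟩ := exists_nullsBelow J
  have hatt := attaches_rule hR hρ r
  -- The predecessor `w` exists even for the first configuration, because `initTGD` adds an edge
  -- from the constant 0.
  let f : ℕ → Value := fun v => if v = 0 then w else g v
  have hfg : ∀ q : Pat, termVal f q.term = termVal g q.term := by
    intro q
    rcases hq : q.term with c | v
    · rfl
    · exact if_neg fun hv : v = 0 => term_ne_zero q (hv ▸ hq)
  have hf : MapsInto f (TGD.body (ruleTGD r ρ)) J := by
    intro α hα
    rcases List.mem_cons.1 hα with rfl | hα
    · rw [map_edge, hfg, hg]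
      exact hw
    · obtain ⟨a, b, hab, rfl⟩ := mem_atoms.1 hα
      rw [map_cell, hfg, hfg, hfg]
      exact hgJ _ (mem_atoms.2 ⟨a, b, hab, rfl⟩)
  set ξ := ruleTGD r ρ with hξ
  have hsub : J ⊆ J ∪ fired ξ f N := Finset.subset_union_left
  have hrep : Rep r (J ∪ fired ξ f N) (ρ.2.subst σ) (termVal (freshExt ξ f N) ρ.2.term) := by
    refine hatt.rep fun v hv => ?_
    rcases hvars _ hv with hv | ⟨a, b, e⟩
    · exact hgσ v hv
    · cases e
  refine ⟨J ∪ fired ξ f N, _, ?_, hatt.functional hf hN h.functional, hrep, ?_,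
    fun w' y hwy => ?_, ⟨_, hatt.edge_mem_iff.2 (Or.inr ⟨rfl, rfl⟩), ?_⟩⟩
  · refine Deriv.step ξ f N h.deriv ?_ hf hN
    simp only [tgds, List.mem_toFinset, List.mem_cons, List.mem_map]
    exact Or.inr ⟨ρ, hρ, rfl⟩
  · obtain ⟨e, he⟩ := h.init
    exact ⟨e, he.mono hsub⟩
  · rcases hatt.edge_mem_iff.1 hwy with hwy | ⟨-, rfl⟩
    · obtain ⟨⟨a, ha⟩, hy⟩ := h.edges w' y hwy
      refine ⟨⟨a, ha.mono hsub⟩, Or.inr ?_⟩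
      rcases hy with rfl | ⟨ρ', hρ', h', h1, h2, h3⟩
      -- The former end of the run now has its rule applied, by the trigger just fired.
      · refine ⟨ρ, hρ, freshExt ξ f N, ?_, ?_, mapsInto_fired ξ f N J⟩
        · exact (hf.congr fun v hv => (freshExt_of_mem hv).symm).mono hsub
        · rw [hatt.freshExt_anchor, hfg, hg]
      · exact ⟨ρ', hρ', h', h1.mono hsub, h2, h3.mono hsub⟩
    · exact ⟨⟨_, hrep⟩, Or.inl rfl⟩
  · rw [hfg, hg]
    exact h.chain.mono hsub

/-- A trigger at the end of the run would rewrite the halted tree. At any earlier configuration some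
rule has been applied, and by determinism it is the rule of the trigger, with the same values on the
left pattern. -/
theorem IsRun.model (hR : WellFormed R) {t s : Tr ℕ} {J : Instance} {k : ℕ} {x : Value}
    (h : IsRun r R t I J k s x) (hs : ∀ s', ¬ Rewrites R s s') :
    Model (tgds r R t).toFinset J := by
  intro ξ hξ f hf
  simp only [tgds, List.mem_toFinset, List.mem_cons, List.mem_map] at hξ
  rcases hξ with rfl | ⟨ρ, hρ, rfl⟩
  · obtain ⟨e, he⟩ := h.init
    exact ⟨e, by simp [initTGD, TGD.body, varsOf], he⟩
  have hroot := (hR.1 ρ hρ).2.1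
  have hfl : MapsInto f (ρ.1.atoms r) J := fun α hα => hf α (List.mem_cons_of_mem _ hα)
  obtain ⟨⟨a, ha⟩, hy⟩ := h.edges _ _ (hf _ List.mem_cons_self)
  have hmatch := subst_treeAt h.functional hfl ha
  rcases hy with hy | ⟨ρ', hρ', g, h1, h2, h3⟩
  · change termVal f ρ.1.term = x at hy
    have : a = s := Rep.unique h.functional ha (by rw [hy]; exact h.rep)
    exact absurd ⟨ρ, hρ, _, hmatch.trans this, rfl⟩ (hs _)
  · have hgl : MapsInto g (ρ'.1.atoms r) J := fun α hα => h1 α (List.mem_cons_of_mem _ hα)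
    change _ = termVal f ρ.1.term at h2
    have hmatch' := subst_treeAt h.functional hgl (by rw [h2]; exact ha)
    obtain rfl := hR.eq_of_subst hρ hρ' (hmatch.trans hmatch'.symm)
    -- The recorded application may use another predecessor; this is harmless, since the variable 0
    -- does not occur in the head.
    refine ⟨fun v => if v = 0 then f 0 else g v, fun v hv => ?_, h3.congr fun v hv => ?_⟩
    · rcases (mem_varsOf_body_ruleTGD hroot).1 hv with rfl | ⟨q, hq, e⟩
      · rfl
      · have hv0 : v ≠ 0 := by
          rintro rfl
          exact term_ne_zero q e
        have := match_unique h.functional hgl hfl h2 q hq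
        rw [e] at this
        simp only [if_neg hv0]
        exact this
    · have hv0 : v ≠ 0 := by
        rintro rfl
        obtain ⟨α, hα, hv⟩ := mem_varsOf.1 hv
        rcases List.mem_cons.1 hα with rfl | hα
        · simp only [Atom.args, edge, List.mem_cons, List.not_mem_nil, or_false] at hv
          exact hv.elim (fun e => term_ne_zero _ e.symm) fun e => term_ne_zero _ e.symm
        · obtain ⟨q, -, e⟩ := exists_of_mem_varsOf_atoms (mem_varsOf.2 ⟨α, hα, hv⟩)
          exact term_ne_zero q e
      exact (if_neg hv0).symm

theorem increasing_of_deriv (hR : WellFormed R) (hI : ∀ a ∈ I, a.1 ≠ r) {a b : Tr ℕ} {J : Instance}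
    (h : Deriv (tgds r R (node a b)).toFinset I J) : Increasing r J := by
  induction h with
  | refl => exact fun x y hxy => absurd rfl (hI _ hxy)
  | step ξ f N _ hξ hf hN ih =>
    simp only [tgds, List.mem_toFinset, List.mem_cons, List.mem_map] at hξ
    rcases hξ with rfl | ⟨ρ, hρ, rfl⟩
    · exact (attaches_init r a b).increasing hf hN ih
    · exact (attaches_rule hR hρ r).increasing hf hN ih

/-- The core chase with the tgds of a rewriting system terminates if and only if the rewriting
halts. -/
theorem coreChaseTerminates_tgds_iff (hR : WellFormed R) (hI : ∀ a ∈ I, a.1 ≠ r) (a b : Tr ℕ) :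
    CoreChaseTerminates (tgds r R (node a b)).toFinset I ↔
      ∃ s, Relation.ReflTransGen (Rewrites R) (node a b) s ∧ ∀ s', ¬ Rewrites R s s' := by
  constructor
  · intro hterm
    by_contra! hno
    obtain ⟨J, U, hJ, ⟨ψ, hψ⟩, hIU, hU⟩ := coreChaseTerminates_iff.1 hterm
    have hrun : ∀ k, ∃ J s x, Relation.ReflTransGen (Rewrites R) (node a b) s ∧
        IsRun r R (node a b) I J k s x := by
      intro k
      induction k with
      | zero =>
        obtain ⟨J, x, h⟩ := exists_isRun_zero (R := R) hI a b
        exact ⟨J, _, x, .refl, h⟩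
      | succ k ih =>
        obtain ⟨J, s, x, hs, h⟩ := ih
        obtain ⟨s', hs'⟩ := hno s hs
        obtain ⟨J', x', h'⟩ := h.step hR hs'
        exact ⟨J', s', x', hs.tail hs', h'⟩
    obtain ⟨N, hN⟩ := exists_nullsBelow J
    -- Counting the initial edge, this run has a chain of `N + 1` edges. Its image in `J` ends at a
    -- value of rank at most `N`, contradicting `Chain.le_rank`.
    obtain ⟨J', s, x, -, h⟩ := hrun N
    obtain ⟨φ, hφ⟩ := h.deriv.homTo_model hIU hU
    have hc := (h.chain.map hφ).map hψ
    have h1 := hc.le_rank (increasing_of_deriv hR hI hJ)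
    obtain ⟨w, hw, -⟩ := hc
    generalize termVal ψ (termVal φ x) = y at h1 hw
    rcases y with c | n
    · exact absurd h1 (by simp [rank])
    · have := hN _ hw n (by simp [Atom.args, edge])
      change N + 1 ≤ n + 1 at h1
      omega
  · rintro ⟨s, hs, hhalt⟩
    have : ∃ J k x, IsRun r R (node a b) I J k s x := by
      clear hhalt
      induction hs with
      | refl =>
        obtain ⟨J, x, h⟩ := exists_isRun_zero (R := R) hI a b
        exact ⟨J, 0, x, h⟩
      | tail _ hs' ih =>
        obtain ⟨J, k, x, h⟩ := ih
        obtain ⟨J', x', h'⟩ := h.step hR hs'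
        exact ⟨J', k + 1, x', h'⟩
    obtain ⟨J, k, x, h⟩ := this
    exact coreChaseTerminates_iff.2 ⟨J, J, h.deriv, HomTo.refl J, HomTo.of_subset h.deriv.subset,
      h.model hR hhalt⟩

end Run

end CoreChase

/-! ### Computability of the translation, and completeness. -/

namespace CoreChase

/-! ### The reduction -/

open Tr

/-- The root and the atoms of a pattern. -/
def packed (r : ℕ) (p : Pat) : Term × List (Atom Term) := (p.term, p.atoms r)

/-- The root and the atoms of a node, from those of its children. -/
def packedNode (r : ℕ) (P Q : Term × List (Atom Term)) : Term × List (Atom Term) :=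
  (nodeTerm P.1 Q.1, cell r (nodeTerm P.1 Q.1) P.1 Q.1 :: (P.2 ++ Q.2))

/-- The recursion runs on pairs of a root term and a list of atoms, so the trees themselves never
have to be encoded. -/
theorem primrec_packedNode (r : ℕ) : Primrec₂ (packedNode r) := by
  have h1 : Primrec fun p : (Term × List (Atom Term)) × (Term × List (Atom Term)) => p.1.1 :=
    Primrec.fst.comp Primrec.fst
  have h2 : Primrec fun p : (Term × List (Atom Term)) × (Term × List (Atom Term)) => p.2.1 :=
    Primrec.fst.comp Primrec.snd
  have h3 : Primrec fun p : (Term × List (Atom Term)) × (Term × List (Atom Term)) =>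
      nodeTerm p.1.1 p.2.1 :=
    Primrec.sumInr.comp (Primrec.succ.comp (Primrec.nat_mul.comp (Primrec.const 2)
      (Primrec.encode.comp (Primrec.pair h1 h2))))
  have h4 : Primrec fun p : (Term × List (Atom Term)) × (Term × List (Atom Term)) =>
      cell r (nodeTerm p.1.1 p.2.1) p.1.1 p.2.1 :=
    Primrec.pair (Primrec.const r) (Primrec.pair h3
      (Primrec.list_cons.comp h1 (Primrec.list_cons.comp h2 (Primrec.const []))))
  exact Primrec.pair h3 (Primrec.list_cons.comp h4
    (Primrec.list_append.comp (Primrec.snd.comp Primrec.fst) (Primrec.snd.comp Primrec.snd)))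

theorem packed_node (r : ℕ) (a b : Tr ℕ) : packed r (ground (node a b)) =
    packedNode r (packed r (ground a)) (packed r (ground b)) := rfl

theorem primrec_packed_node (r : ℕ) {f g : ℕ → Tr ℕ}
    (hf : Primrec fun n => packed r (ground (f n)))
    (hg : Primrec fun n => packed r (ground (g n))) :
    Primrec fun n => packed r (ground (node (f n) (g n))) := by
  have h : Primrec fun n => packedNode r (packed r (ground (f n))) (packed r (ground (g n))) :=
    Primrec₂.comp (primrec_packedNode r) hf hg
  simpa only [packed_node] using h

theorem primrec_packed_natTree (r : ℕ) : Primrec fun n => packed r (ground (natTree n)) := by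
  have h : Primrec fun n : ℕ => (Nat.rec (packed r (ground (leaf 0)))
      (fun _ P => packedNode r (packed r (ground (leaf 0))) P) n : Term × List (Atom Term)) :=
    Primrec.nat_rec' Primrec.id (Primrec.const _)
      ((primrec_packedNode r).comp (Primrec.const _) (Primrec.snd.comp Primrec.snd)).to₂
  refine h.of_eq fun n => ?_
  induction n with
  | zero => rfl
  | succ n ih =>
    rw [natTree, packed_node, ← ih]

/-- Only the numeral inside the initial tree depends on `n`; the rule tgds are constant. -/
theorem computable_tgds (r : ℕ) (R : List (Pat × Pat)) (c : Turing.ToPartrec.Code) :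
    Computable fun n => tgds r R (evTree c .halt [n]) := by
  have hc : ∀ t : Tr ℕ, Primrec fun _ : ℕ => packed r (ground t) := fun t => Primrec.const _
  have hp : Primrec fun n => packed r (ground (evTree c .halt [n])) :=
    primrec_packed_node r (hc _) (primrec_packed_node r (hc _) (primrec_packed_node r (hc _)
      (primrec_packed_node r (primrec_packed_natTree r) (hc (leaf 0)))))
  have hi : Primrec fun n => initTGD r (ground (evTree c .halt [n])) := by
    refine Primrec.pair (Primrec.const []) (Primrec.list_cons.comp ?_ (Primrec.snd.comp hp))
    exact Primrec.pair (Primrec.const r) (Primrec.pair (Primrec.const (Sum.inl 0))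
      (Primrec.list_cons.comp (Primrec.fst.comp hp) (Primrec.const [])))
  exact (Primrec.list_cons.comp hi (Primrec.const _)).to_comp

theorem exists_code_dom {q : ℕ → Prop} (hq : REPred q) :
    ∃ c : Turing.ToPartrec.Code, ∀ n, (c.eval [n]).Dom ↔ q n := by
  have h1 : Partrec fun n : ℕ => (Part.assert (q n) fun _ => Part.some ()).map fun _ => (0 : ℕ) :=
    Partrec.map hq (Computable.const 0).to₂
  obtain ⟨c, hc⟩ := Turing.ToPartrec.Code.exists_code (Nat.Partrec'.part_iff₁.2 h1)
  refine ⟨c, fun n => ?_⟩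
  have h2 := hc (n ::ᵥ List.Vector.nil)
  change c.eval [n] = _ at h2
  rw [h2]
  exact exists_prop.trans (and_iff_left trivial)

theorem exists_reduction (I : Instance) {q : ℕ → Prop} (hq : REPred q) :
    ∃ f : ℕ → List TGD, Computable f ∧ ∀ n, q n ↔ (f n).toFinset ∈ CTcore I := by
  obtain ⟨c, hc⟩ := exists_code_dom hq
  -- A relation name not used in `I` keeps the simulation apart from the atoms of `I`.
  obtain ⟨r, hr⟩ := Infinite.exists_notMem_finset (I.image Prod.fst)
  refine ⟨fun n => tgds r Interp.rules (evTree c .halt [n]), computable_tgds r _ c, fun n => ?_⟩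
  rw [← hc n, eval_dom_iff]
  exact (coreChaseTerminates_tgds_iff Interp.wellFormed_rules
    (fun a ha e => hr (Finset.mem_image.2 ⟨a, ha, e⟩)) _ _).symm

end CoreChase

/-- Finite sets of tgds, and in the second part also instances, are given to the machine as lists of
their elements. -/
theorem mainTheorem6 :
    (∀ I : CoreChase.Instance,
      CoreChase.REComplete fun S : List CoreChase.TGD => S.toFinset ∈ CoreChase.CTcore I) ∧
    CoreChase.REComplete
      fun P : List (CoreChase.Atom CoreChase.Value) × List CoreChase.TGD =>
        P.2.toFinset ∈ CoreChase.CTcore P.1.toFinset := by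
  refine ⟨fun I => ⟨CoreChase.rePred_CTcore I, fun q hq => ?_⟩, CoreChase.rePred_pairs,
    fun q hq => ?_⟩
  · exact CoreChase.exists_reduction I hq
  -- With the instance in the input, the reduction can always output the empty one.
  · obtain ⟨f, hf, hqf⟩ := CoreChase.exists_reduction ∅ hq
    exact ⟨fun n => ([], f n), (Computable.const []).pair hf, fun n => by simpa using hqf n⟩
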